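/- Let $0<p<4$ and $f(u)=|u|^pu$. For $h>0$ let $l^r(h\mathbb Z)$ be the space of functions $u:h\mathbb Z\to\mathbb C$ with finite norm $\|u\|_{l^r(h\mathbb Z)}=\big(h\sum_{j}|u(jh)|^r\big)^{1/r}$ if $1\le r<\infty$, $\|u\|_{l^\infty(h\mathbb Z)}=\sup_j|u(jh)|$, and put $(u,v)_h=\mathrm{Re}\,\big(h\sum_j u(jh)\overline{v(jh)}\big)$. A pair $(q,r)$ is called $1/2$-admissible if $2\le q,r\le\infty$ and $\frac1q=\frac12\big(\frac12-\frac1r\big)$. For every $K>0$ there exist $c>0$, depending only on $p$ and $K$, and constants $C(q)>0$, depending only on $p$, $q$ and $K$, such that the following holds for every $h>0$ (so $c$ and $C(q)$ do not depend on $h$). Let $A_h$ be a bounded linear operator on $l^2(h\mathbb Z)$ with $$\mathrm{Re}\,(iA_h\varphi,\varphi)_h\le 0\quad\text{for all }\varphi\in l^2(h\mathbb Z)$$ and $$\|\exp(itA_h)\varphi\|_{l^\infty(h\mathbb Z)}\le \frac{K}{t^{1/2}}\,\|\varphi\|_{l^1(h\mathbb Z)}\quad\text{for all }t>0,\ \varphi\in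 l^1(h\mathbb Z).$$ Then for every $\varphi^h\in l^2(h\mathbb Z)$ the semi-discrete nonlinear Schrödinger equation $$i\,u^h_t+A_hu^h=f(u^h),\qquad u^h(0)=\varphi^h,$$ has a unique global solution $u^h\in C(\mathbb R,l^2(h\mathbb Z))$. Its restriction to $[0,\infty)$ is also the unique solution in $C([0,\infty),l^2(h\mathbb Z))$ of the equation for $t>0$. It satisfies $$\|u^h(t)\|_{l^2(h\mathbb Z)}\le\|\varphi^h\|_{l^2(h\mathbb Z)}\quad\text{for all }t\ge 0,$$ and for every $1/2$-admissible pair $(q,r)$ and every bounded interval $I\subset[0,\infty)$ of length $|I|\le c\,\|\varphi^h\|_{l^2(h\mathbb Z)}^{-4p/(4-p)}$ (no restriction on $|I|$ if $\varphi^h=0$), $$\|u^h\|_{L^q(I,\,l^r(h\mathbb Z))}\le C(q)\,\|\varphi^h\|_{l^2(h\mathbb Z)}.$$ If moreover $\mathrm{Re}\,(iA_h\varphi,\varphi)_h=0$ for all $\varphi\in l^2(h\mathbb Z)$, the last two estimates hold for all $t\in\mathbb R$ and for all such bounded intervals $I\subset\mathbb R$, respectively. -/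

import Mathlib

open MeasureTheory Set
open scoped ENNReal NNReal

noncomputable section

namespace SemiDiscreteNLS

/-- Square-summable complex grid functions. A function `u` on the mesh `hℤ` is written as the
sequence `j ↦ u (j h)`, so for every `h > 0` this is the vector space `l²(hℤ)`; the norm of `l²(hℤ)`
is `gridNorm h 2`, i.e. `√h` times the norm carried by this type (hence the topology, bounded
operators, derivatives in time and exponentials of operators are the same for both norms). -/
abbrev GridL2 : Type := lp (fun _ : ℤ => ℂ) 2

/-- The measure on the mesh `hℤ` (indexed by `ℤ`) giving mass `h` to every point. -/
def gridMeasure (h : ℝ) : Measure ℤ := ENNReal.ofReal h • Measure.count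

/-- The (possibly infinite) norm of `l^r(hℤ)`: `(h ∑ⱼ |u(jh)|^r)^{1/r}` for `1 ≤ r < ∞`,
`supⱼ |u(jh)|` for `r = ∞`; see `gridNorm_eq_tsum` and `gridNorm_top`. -/
def gridNorm (h : ℝ) (r : ℝ≥0∞) (u : ℤ → ℂ) : ℝ≥0∞ := eLpNorm u r (gridMeasure h)

theorem gridNorm_eq_tsum (h : ℝ) {r : ℝ≥0∞} (hr0 : r ≠ 0) (hr : r ≠ ∞) (u : ℤ → ℂ) :
    gridNorm h r u =
      (ENNReal.ofReal h * ∑' j : ℤ, ‖u j‖ₑ ^ r.toReal) ^ (1 / r.toReal) := by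
  rw [gridNorm, eLpNorm_eq_lintegral_rpow_enorm_toReal hr0 hr, gridMeasure,
    lintegral_smul_measure, lintegral_count, smul_eq_mul]

theorem gridNorm_top {h : ℝ} (hh : 0 < h) (u : ℤ → ℂ) :
    gridNorm h ∞ u = ⨆ j : ℤ, ‖u j‖ₑ := by
  have hm : ∀ j : ℤ, gridMeasure h {j} ≠ 0 := fun j => by
    simpa [gridMeasure] using hh
  rw [gridNorm, eLpNorm_exponent_top, eLpNormEssSup]
  exact essSup_eq_iSup hm (fun j => ‖u j‖ₑ)

theorem gridNorm_two {h : ℝ} (hh : 0 ≤ h) (u : GridL2) :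
    gridNorm h 2 (fun j => u j) = ENNReal.ofReal (Real.sqrt h * ‖u‖) := by
  have hs : HasSum (fun j : ℤ => ‖u j‖ ^ (2 : ℝ)) (‖u‖ ^ (2 : ℝ)) := by
    simpa using lp.hasSum_norm (p := 2) (by norm_num) u
  have key : (∑' j : ℤ, ‖u j‖ₑ ^ (2 : ℝ)) = ENNReal.ofReal (‖u‖ ^ (2 : ℝ)) := by
    rw [← hs.tsum_eq, ENNReal.ofReal_tsum_of_nonneg (fun j => by positivity) hs.summable]
    refine tsum_congr fun j => ?_
    rw [← ENNReal.ofReal_rpow_of_nonneg (norm_nonneg _) (by norm_num), ofReal_norm]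
  rw [gridNorm_eq_tsum h (by norm_num) (by norm_num), ENNReal.toReal_ofNat, key,
    ← ENNReal.ofReal_mul hh, ENNReal.ofReal_rpow_of_nonneg (by positivity) (by norm_num),
    Real.mul_rpow hh (by positivity), ← Real.sqrt_eq_rpow, ← Real.rpow_mul (norm_nonneg _)]
  norm_num

/-- The real scalar product `(u, v)_h = Re (h ∑ⱼ u(jh) conj v(jh))` of `l²(hℤ)`. -/
def gridInner (h : ℝ) (u v : GridL2) : ℝ :=
  ((h : ℂ) * ∑' j : ℤ, u j * (starRingEnd ℂ) (v j)).re

/-- The group of operators `exp(i t A)`, `A` a bounded operator of `l²(hℤ)`. -/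
def propagator (A : GridL2 →L[ℂ] GridL2) (t : ℝ) : GridL2 →L[ℂ] GridL2 :=
  NormedSpace.exp (((t : ℂ) * Complex.I) • A)

/-- `Re (i A φ, φ)_h ≤ 0` for all `φ ∈ l²(hℤ)` (the scalar product is real valued). -/
def IsDissipative (h : ℝ) (A : GridL2 →L[ℂ] GridL2) : Prop :=
  ∀ φ : GridL2, gridInner h (Complex.I • A φ) φ ≤ 0

/-- The conservative case `Re (i A φ, φ)_h = 0` for all `φ ∈ l²(hℤ)`. -/
def IsConservative (h : ℝ) (A : GridL2 →L[ℂ] GridL2) : Prop :=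
  ∀ φ : GridL2, gridInner h (Complex.I • A φ) φ = 0

/-- The dispersive estimate
`‖exp(i t A) φ‖_{l^∞(hℤ)} ≤ K t^{-1/2} ‖φ‖_{l¹(hℤ)}` for `t > 0`, `φ ∈ l¹(hℤ)` (and
`l¹(hℤ) ⊆ l²(hℤ)`). -/
def IsDispersive (h K : ℝ) (A : GridL2 →L[ℂ] GridL2) : Prop :=
  ∀ t : ℝ, 0 < t → ∀ φ : GridL2, gridNorm h 1 (fun j => φ j) < ∞ →
    gridNorm h ∞ (fun j => propagator A t φ j) ≤
      ENNReal.ofReal (K / t ^ (1 / 2 : ℝ)) * gridNorm h 1 (fun j => φ j)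

/-- `u ∈ C(J, l²(hℤ))` solves `i u_t + A u = |u|^p u` in the interior of the time interval `J`,
with `u(0) = φ`; the derivative in time is taken in `l²(hℤ)`. -/
structure IsSolutionOn (p : ℝ) (A : GridL2 →L[ℂ] GridL2) (φ : GridL2) (J : Set ℝ)
    (u : ℝ → GridL2) : Prop where
  continuousOn : ContinuousOn u J
  initial : u 0 = φ
  equation : ∀ t ∈ interior J, ∃ u' : GridL2, HasDerivAt u u' t ∧
    ∀ j : ℤ, Complex.I * u' j + A (u t) j = ((‖u t j‖ ^ p : ℝ) : ℂ) * u t j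

/-- `1/2`-admissible pairs: `2 ≤ q, r ≤ ∞` and `1/q = 1/2 (1/2 - 1/r)`. -/
def IsAdmissible (q r : ℝ≥0∞) : Prop :=
  2 ≤ q ∧ 2 ≤ r ∧ q⁻¹ = 2⁻¹ * (2⁻¹ - r⁻¹)

/-- The norm of `L^q(I, l^r(hℤ))`. -/
def mixedNorm (h : ℝ) (q r : ℝ≥0∞) (I : Set ℝ) (u : ℝ → GridL2) : ℝ≥0∞ :=
  eLpNorm (fun t => gridNorm h r (fun j => u t j)) q (volume.restrict I)

/-- On the time set `J`, the function `u` satisfies `‖u(t)‖_{l²(hℤ)} ≤ ‖φ‖_{l²(hℤ)}`, and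
`‖u‖_{L^q(I, l^r(hℤ))} ≤ C(q) ‖φ‖_{l²(hℤ)}` for all `1/2`-admissible `(q, r)` and all bounded
intervals `I ⊆ J` of length at most `c ‖φ‖_{l²(hℤ)}^{-4p/(4-p)}` (which is `∞` for `φ = 0`). -/
structure SatisfiesBounds (h p c : ℝ) (C : ℝ≥0∞ → ℝ≥0) (φ : GridL2) (J : Set ℝ)
    (u : ℝ → GridL2) : Prop where
  energy : ∀ t ∈ J, gridNorm h 2 (fun j => u t j) ≤ gridNorm h 2 (fun j => φ j)
  strichartz : ∀ q r : ℝ≥0∞, IsAdmissible q r → ∀ a b : ℝ, a ≤ b → Icc a b ⊆ J →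
    ENNReal.ofReal (b - a) ≤
      ENNReal.ofReal c * gridNorm h 2 (fun j => φ j) ^ (-(4 * p / (4 - p))) →
    mixedNorm h q r (Icc a b) u ≤ C q * gridNorm h 2 (fun j => φ j)

end SemiDiscreteNLS

end

/-! Since `A` is bounded and `|u|^p u` is locally Lipschitz on `l²`, the equation is an ODE in a
Hilbert space. The nonlinearity does not contribute to `d/dt ‖u‖²`, so `|⟪u, u'⟫| ≤ ‖A‖ ‖u‖²` rules
out blow-up in both time directions, and the sign of `Re (iAφ, φ)` gives decay or conservation of
the `l²` norm.

The bounds uniform in `h` rest on the Strichartz estimate in `L⁴(l^∞)` with source in `L¹(l²)`,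
`integral_supNorm_pow_four_le`. As `exp(itA)` need not be unitary, the `TT*` argument is replaced by
duality with the backward problem `w' = -B†w - F`, `w(b) = 0`, where `B = iA`. Dissipativity gives
`‖w(t)‖² ≤ 2 ∫ ⟪w, F⟫`, and Duhamel's formula expresses `⟪w(s), F(s)⟫` through `⟪F(r), exp((r-s)B)
F(s)⟫` with `r > s`. The dispersive bound and the Hardy–Littlewood–Sobolev inequality
`lintegral_lintegral_rieszKernel_le` then control `w` in `L^∞(l²)` by `F` in `L^{4/3}(l¹)`. Pairing
`w` with `u`, for an `F` with `‖F‖_{l¹} ≤ ‖u‖_∞³` and `⟪F, u⟫` close to `‖u‖_∞⁴`, gives the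
estimate.

For the nonlinear equation the source has `l²` norm at most `‖u‖_∞^p ‖u‖`. Because `p < 4`, its time
integral carries the factor `l^{1-p/4}` on an interval of length `l`, so a continuity argument
closes on short intervals (`integral_supNorm_pow_four_le_of_short`). Interpolation with the energy
bound yields all admissible pairs. The argument on `[a, b]` runs forward from `a` and uses only `‖u‖
≤ ‖φ‖` there, so negative times in the conservative case need no time reversal. Uniformity in `h`
holds because the dispersive constant in the unweighted norms is `hK` and `√h ‖·‖` is the norm of
`l²(hℤ)`. -/

noncomputable section

namespace SemiDiscreteNLS

/-! ### Global solutions of locally Lipschitz ODEs in a Hilbert space. -/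

section ODE

open Metric

variable {E : Type*} [NormedAddCommGroup E]

theorem exists_bound_of_lipschitzOn {V : E → E} {K : ℝ≥0} {R : ℝ}
    (h : LipschitzOnWith K V (closedBall 0 R)) :
    ∀ x ∈ closedBall (0 : E) R, ‖V x‖ ≤ K * R + ‖V 0‖ := by
  intro x hx
  have hx' : ‖x‖ ≤ R := by simpa using hx
  have hR : 0 ≤ R := (norm_nonneg x).trans hx'
  have := h.norm_sub_le hx (mem_closedBall_self hR)
  rw [sub_zero] at this
  have h2 : ‖V x‖ ≤ ‖V x - V 0‖ + ‖V 0‖ := by simpa using norm_add_le (V x - V 0) (V 0)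
  have : (K : ℝ) * ‖x‖ ≤ K * R := by gcongr
  linarith

/-- Cut-off multiplying a vector field: `1` on the ball of radius `R`, `0` off that of radius `R+1`. -/
def cutoff (R : ℝ) (x : E) : ℝ := max 0 (min 1 (R + 1 - ‖x‖))

theorem cutoff_nonneg (R : ℝ) (x : E) : 0 ≤ cutoff R x := le_max_left _ _

theorem cutoff_le_one (R : ℝ) (x : E) : cutoff R x ≤ 1 :=
  max_le zero_le_one (min_le_left _ _)

theorem cutoff_eq_one {R : ℝ} {x : E} (h : ‖x‖ ≤ R) : cutoff R x = 1 := by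
  rw [cutoff, min_eq_left (by linarith), max_eq_right zero_le_one]

theorem cutoff_eq_zero {R : ℝ} {x : E} (h : R + 1 ≤ ‖x‖) : cutoff R x = 0 := by
  rw [cutoff, max_eq_left]
  exact (min_le_right _ _).trans (by linarith)

theorem abs_cutoff_sub_le (R : ℝ) (x y : E) : |cutoff R x - cutoff R y| ≤ ‖x - y‖ := by
  have h1 : |max 0 (min 1 (R + 1 - ‖x‖)) - max 0 (min 1 (R + 1 - ‖y‖))|
      ≤ |min 1 (R + 1 - ‖x‖) - min 1 (R + 1 - ‖y‖)| := by
    simpa using abs_max_sub_max_le_max 0 (min 1 (R + 1 - ‖x‖)) 0 (min 1 (R + 1 - ‖y‖))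
  have h2 : |min 1 (R + 1 - ‖x‖) - min 1 (R + 1 - ‖y‖)| ≤ |(R + 1 - ‖x‖) - (R + 1 - ‖y‖)| := by
    simpa using abs_min_sub_min_le_max 1 (R + 1 - ‖x‖) 1 (R + 1 - ‖y‖)
  have h3 : |(R + 1 - ‖x‖) - (R + 1 - ‖y‖)| = |‖y‖ - ‖x‖| := by congr 1; ring
  refine h1.trans (h2.trans (h3.le.trans ?_))
  rw [abs_sub_comm]
  exact abs_norm_sub_norm_le x y

variable [InnerProductSpace ℝ E]

/-- If `|⟪V x, x⟫| ≤ b ‖x‖²` along `u`, then `‖u‖` grows at most exponentially in both directions. -/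
theorem norm_sq_le_of_abs_inner_deriv_le {u u' : ℝ → E} {b T : ℝ} (hT : 0 ≤ T)
    (hu : ∀ t ∈ Icc (-T) T, HasDerivWithinAt u (u' t) (Icc (-T) T) t)
    (hb : ∀ t ∈ Icc (-T) T, |inner ℝ (u t) (u' t)| ≤ b * ‖u t‖ ^ 2) :
    ∀ t ∈ Icc (-T) T, ‖u t‖ ^ 2 ≤ Real.exp (2 * b * |t|) * ‖u 0‖ ^ 2 := by
  have key : ∀ c : ℝ, ∀ t ∈ Icc (-T) T,
      HasDerivWithinAt (fun t => Real.exp (c * t) * ‖u t‖ ^ 2)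
        (Real.exp (c * t) * (c * ‖u t‖ ^ 2 + 2 * inner ℝ (u t) (u' t))) (Icc (-T) T) t := by
    intro c t ht
    have h1 : HasDerivAt (fun t : ℝ => Real.exp (c * t)) (Real.exp (c * t) * (c * 1)) t :=
      ((hasDerivAt_id t).const_mul c).exp
    refine (h1.hasDerivWithinAt.mul (hu t ht).norm_sq).congr_deriv ?_
    ring
  have int : ∀ t ∈ interior (Icc (-T) T), t ∈ Icc (-T) T := fun t ht => interior_subset ht
  have anti : AntitoneOn (fun t => Real.exp (-(2 * b) * t) * ‖u t‖ ^ 2) (Icc (-T) T) := by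
    refine antitoneOn_of_hasDerivWithinAt_nonpos (convex_Icc _ _)
      (fun t ht => (key _ t ht).continuousWithinAt)
      (fun t ht => (key _ t (int t ht)).mono interior_subset) (fun t ht => ?_)
    have := abs_le.1 (hb t (int t ht))
    exact mul_nonpos_of_nonneg_of_nonpos (Real.exp_pos _).le (by linarith)
  have mono : MonotoneOn (fun t => Real.exp (2 * b * t) * ‖u t‖ ^ 2) (Icc (-T) T) := by
    refine monotoneOn_of_hasDerivWithinAt_nonneg (convex_Icc _ _)
      (fun t ht => (key _ t ht).continuousWithinAt)
      (fun t ht => (key _ t (int t ht)).mono interior_subset) (fun t ht => ?_)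
    have := abs_le.1 (hb t (int t ht))
    exact mul_nonneg (Real.exp_pos _).le (by linarith)
  have h0 : (0 : ℝ) ∈ Icc (-T) T := ⟨by linarith, hT⟩
  intro t ht
  rcases le_total 0 t with h | h
  · have := anti h0 ht h
    simp only [mul_zero, Real.exp_zero, one_mul] at this
    rw [abs_of_nonneg h]
    calc ‖u t‖ ^ 2 = Real.exp (2 * b * t) * (Real.exp (-(2 * b) * t) * ‖u t‖ ^ 2) := by
          rw [← mul_assoc, ← Real.exp_add]; ring_nf; simp
      _ ≤ _ := by gcongr
  · have := mono ht h0 h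
    simp only [mul_zero, Real.exp_zero, one_mul] at this
    rw [abs_of_nonpos h]
    calc ‖u t‖ ^ 2 = Real.exp (2 * b * -t) * (Real.exp (2 * b * t) * ‖u t‖ ^ 2) := by
          rw [← mul_assoc, ← Real.exp_add]; ring_nf; simp
      _ ≤ _ := by gcongr

/-- The cut-off field is bounded on the whole space, so Picard–Lindelöf reaches any prescribed `T`
in one application, without gluing short-time solutions. -/
theorem exists_solution_cutoff [CompleteSpace E] {V : E → E}
    (hlip : ∀ R : ℝ, ∃ K : ℝ≥0, LipschitzOnWith K V (closedBall 0 R)) (φ : E) (R : ℝ) {T : ℝ}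
    (hT : 0 ≤ T) :
    ∃ u : ℝ → E, u 0 = φ ∧ ∀ t ∈ Icc (-T) T,
      HasDerivWithinAt u (cutoff R (u t) • V (u t)) (Icc (-T) T) t := by
  obtain ⟨K₁, hK₁⟩ := hlip (R + 1)
  set L : ℝ≥0 := (K₁ * (R + 1) + ‖V 0‖).toNNReal with hL
  have hbound : ∀ x : E, ‖cutoff R x • V x‖ ≤ L := by
    intro x
    rcases le_total ‖x‖ (R + 1) with h | h
    · rw [norm_smul, Real.norm_of_nonneg (cutoff_nonneg _ _)]
      have h1 := exists_bound_of_lipschitzOn hK₁ x (by simpa using h)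
      calc _ ≤ 1 * ‖V x‖ := by gcongr; exact cutoff_le_one _ _
        _ ≤ L := by rw [one_mul, hL]; exact h1.trans (Real.le_coe_toNNReal _)
    · simp [cutoff_eq_zero h]
  -- A curve of speed at most `L` moves by at most `L T` on `[-T, T]`, so it cannot leave this ball.
  set a : ℝ≥0 := L * T.toNNReal with ha
  obtain ⟨K₂, hK₂⟩ := hlip (‖φ‖ + a)
  set M : ℝ≥0 := (K₂ * (‖φ‖ + a) + ‖V 0‖).toNNReal with hM
  have hsub : closedBall φ a ⊆ closedBall (0 : E) (‖φ‖ + a) :=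
    closedBall_subset_closedBall' (by simp [add_comm])
  have hPL : IsPicardLindelof (fun _ x => cutoff R x • V x) (tmin := -T) (tmax := T)
      ⟨0, by simpa using hT, hT⟩ φ a 0 L (M + K₂) := by
    refine ⟨fun t _ => ?_, fun x _ => continuousOn_const, fun t _ x _ => hbound x, ?_⟩
    · refine LipschitzOnWith.of_dist_le_mul fun x hx y hy => ?_
      have hx' := hsub hx
      have hy' := hsub hy
      have e : cutoff R x • V x - cutoff R y • V y
          = (cutoff R x - cutoff R y) • V x + cutoff R y • (V x - V y) := by
        rw [sub_smul, smul_sub]; abel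
      rw [dist_eq_norm, dist_eq_norm, e]
      refine (norm_add_le _ _).trans ?_
      rw [norm_smul, norm_smul, Real.norm_of_nonneg (cutoff_nonneg _ _), Real.norm_eq_abs]
      have h1 : ‖V x‖ ≤ M := (exists_bound_of_lipschitzOn hK₂ x hx').trans (Real.le_coe_toNNReal _)
      have h2 : ‖V x - V y‖ ≤ K₂ * ‖x - y‖ := hK₂.norm_sub_le hx' hy'
      have h3 := abs_cutoff_sub_le R x y
      have h4 := cutoff_le_one R y
      calc _ ≤ ‖x - y‖ * M + 1 * (K₂ * ‖x - y‖) := by gcongr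
        _ = _ := by push_cast; ring
    · simp [ha, Real.coe_toNNReal T hT]
  obtain ⟨u, h0, hu⟩ := hPL.exists_eq_forall_mem_Icc_hasDerivWithinAt₀
  exact ⟨u, h0, hu⟩

/-- A cut-off factor in `[0, 1]` preserves the bound on the inner product. The truncated solution
therefore stays in the ball of radius `exp(bT) ‖φ‖`, where the cut-off equals `1`. -/
theorem exists_solution_Icc [CompleteSpace E] {V : E → E}
    (hlip : ∀ R : ℝ, ∃ K : ℝ≥0, LipschitzOnWith K V (closedBall 0 R)) {b : ℝ} (hb0 : 0 ≤ b)
    (hb : ∀ x, |inner ℝ x (V x)| ≤ b * ‖x‖ ^ 2) (φ : E) {T : ℝ} (hT : 0 ≤ T) :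
    ∃ u : ℝ → E, u 0 = φ ∧ ∀ t ∈ Icc (-T) T, HasDerivWithinAt u (V (u t)) (Icc (-T) T) t := by
  set R := Real.exp (b * T) * ‖φ‖
  obtain ⟨u, h0, hu⟩ := exists_solution_cutoff hlip φ R hT
  have hle : ∀ t ∈ Icc (-T) T, ‖u t‖ ≤ R := by
    intro t ht
    have := norm_sq_le_of_abs_inner_deriv_le hT hu (b := b) (fun s _ => by
      rw [inner_smul_right, abs_mul, abs_of_nonneg (cutoff_nonneg _ _)]
      exact (mul_le_of_le_one_left (abs_nonneg _) (cutoff_le_one _ _)).trans (hb _)) t ht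
    refine le_of_sq_le_sq ?_ (by positivity)
    rw [mul_pow, ← Real.exp_nat_mul]
    refine this.trans ?_
    rw [h0]
    have : |t| ≤ T := abs_le.2 ht
    gcongr ?_ * _
    rw [Real.exp_le_exp]
    push_cast
    nlinarith
  refine ⟨u, h0, fun t ht => ?_⟩
  have := hu t ht
  rwa [cutoff_eq_one (hle t ht), one_smul] at this

theorem eqOn_Icc_of_hasDerivAt {V : E → E}
    (hlip : ∀ R : ℝ, ∃ K : ℝ≥0, LipschitzOnWith K V (closedBall 0 R)) {u v : ℝ → E} {a b t₀ : ℝ}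
    (ht₀ : t₀ ∈ Ioo a b) (huc : ContinuousOn u (Icc a b)) (hvc : ContinuousOn v (Icc a b))
    (hu : ∀ t ∈ Ioo a b, HasDerivAt u (V (u t)) t) (hv : ∀ t ∈ Ioo a b, HasDerivAt v (V (v t)) t)
    (h0 : u t₀ = v t₀) : EqOn u v (Icc a b) := by
  obtain ⟨R₁, hR₁⟩ := isCompact_Icc.exists_bound_of_continuousOn huc
  obtain ⟨R₂, hR₂⟩ := isCompact_Icc.exists_bound_of_continuousOn hvc
  obtain ⟨K, hK⟩ := hlip (max R₁ R₂)
  refine ODE_solution_unique_of_mem_Icc (v := fun _ => V) (s := fun _ => closedBall 0 (max R₁ R₂))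
    (fun _ _ => hK) ht₀ huc hu (fun t ht => ?_) hvc hv (fun t ht => ?_) h0
  · simpa using Or.inl (hR₁ t (Ioo_subset_Icc_self ht))
  · simpa using Or.inr (hR₂ t (Ioo_subset_Icc_self ht))

theorem eqOn_Icc_of_hasDerivWithinAt_right {V : E → E}
    (hlip : ∀ R : ℝ, ∃ K : ℝ≥0, LipschitzOnWith K V (closedBall 0 R)) {u v : ℝ → E} {a b : ℝ}
    (huc : ContinuousOn u (Icc a b)) (hvc : ContinuousOn v (Icc a b))
    (hu : ∀ t ∈ Ico a b, HasDerivWithinAt u (V (u t)) (Ici t) t)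
    (hv : ∀ t ∈ Ico a b, HasDerivWithinAt v (V (v t)) (Ici t) t)
    (h0 : u a = v a) : EqOn u v (Icc a b) := by
  obtain ⟨R₁, hR₁⟩ := isCompact_Icc.exists_bound_of_continuousOn huc
  obtain ⟨R₂, hR₂⟩ := isCompact_Icc.exists_bound_of_continuousOn hvc
  obtain ⟨K, hK⟩ := hlip (max R₁ R₂)
  refine ODE_solution_unique_of_mem_Icc_right (v := fun _ => V)
    (s := fun _ => closedBall 0 (max R₁ R₂))
    (fun _ _ => hK) huc hu (fun t ht => ?_) hvc hv (fun t ht => ?_) h0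
  · simpa using Or.inl (hR₁ t (Ico_subset_Icc_self ht))
  · simpa using Or.inr (hR₂ t (Ico_subset_Icc_self ht))

theorem exists_global_solution [CompleteSpace E] {V : E → E}
    (hlip : ∀ R : ℝ, ∃ K : ℝ≥0, LipschitzOnWith K V (closedBall 0 R)) {b : ℝ} (hb0 : 0 ≤ b)
    (hb : ∀ x, |inner ℝ x (V x)| ≤ b * ‖x‖ ^ 2) (φ : E) :
    ∃ u : ℝ → E, u 0 = φ ∧ ∀ t, HasDerivAt u (V (u t)) t := by
  have hex := fun n : ℕ => exists_solution_Icc hlip hb0 hb φ (T := (n : ℝ) + 1) (by positivity)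
  choose w hw0 hw using hex
  have hd : ∀ n : ℕ, ∀ t ∈ Ioo (-((n : ℝ) + 1)) (n + 1), HasDerivAt (w n) (V (w n t)) t :=
    fun n t ht => (hw n t (Ioo_subset_Icc_self ht)).hasDerivAt (Icc_mem_nhds ht.1 ht.2)
  have heq : ∀ n m : ℕ, n ≤ m → EqOn (w n) (w m) (Icc (-((n : ℝ) + 1)) (n + 1)) := by
    intro n m hnm
    have hnm' : (n : ℝ) ≤ m := by exact_mod_cast hnm
    have hs : Icc (-((n : ℝ) + 1)) (n + 1) ⊆ Icc (-((m : ℝ) + 1)) (m + 1) :=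
      Icc_subset_Icc (by linarith) (by linarith)
    have hs' : Ioo (-((n : ℝ) + 1)) (n + 1) ⊆ Ioo (-((m : ℝ) + 1)) (m + 1) :=
      Ioo_subset_Ioo (by linarith) (by linarith)
    refine eqOn_Icc_of_hasDerivAt hlip (t₀ := 0) ⟨?_, ?_⟩
      (fun t ht => (hw n t ht).continuousWithinAt)
      (fun t ht => (hw m t (hs ht)).continuousWithinAt.mono hs) (hd n)
      (fun t ht => hd m t (hs' ht)) (by rw [hw0, hw0])
    · have : (0 : ℝ) ≤ n := n.cast_nonneg
      linarith
    · positivity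
  -- `w n` lives on `[-(n+1), n+1]`; near `t` the glued function agrees with the single solution of
  -- index `⌈|t|⌉ + 1`, because `|s| < ⌈|t|⌉ + 1` is an open condition.
  refine ⟨fun t => w ⌈|t|⌉₊ t, by simp [hw0], fun t => ?_⟩
  set n : ℕ := ⌈|t|⌉₊ + 1 with hn
  have hlt : |t| < n := by
    have := Nat.le_ceil |t|
    rw [hn]; push_cast; linarith
  have hev : ∀ s : ℝ, |s| < n → w ⌈|s|⌉₊ s = w n s := by
    intro s hs
    refine heq _ _ (Nat.ceil_le.2 hs.le) (abs_le.1 ?_)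
    have := Nat.le_ceil |s|
    linarith
  have hmem : ∀ᶠ s : ℝ in nhds t, |s| < n := continuous_abs.continuousAt.eventually (gt_mem_nhds hlt)
  have h1 : HasDerivAt (w n) (V (w n t)) t :=
    hd n t (abs_lt.1 (by linarith))
  rw [← hev t hlt] at h1
  exact h1.congr_of_eventuallyEq (hmem.mono hev)

/-- A solution on `(a, ∞)` that is continuous up to `a` has a right derivative at `a`. -/
theorem hasDerivWithinAt_Ici_of_solution {V u : _} {a : ℝ} (hV : Continuous (V : E → E))
    (hc : ContinuousOn (u : ℝ → E) (Ici a)) (hu : ∀ t ∈ Ioi a, HasDerivAt u (V (u t)) t) :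
    HasDerivWithinAt u (V (u a)) (Ici a) a := by
  refine hasDerivWithinAt_Ici_of_tendsto_deriv (s := Ioi a)
    (fun t ht => (hu t ht).differentiableAt.differentiableWithinAt)
    ((hc a self_mem_Ici).mono Ioi_subset_Ici_self) self_mem_nhdsWithin ?_
  have h1 : Filter.Tendsto (fun t => V (u t)) (nhdsWithin a (Ioi a)) (nhds (V (u a))) :=
    (hV.tendsto _).comp ((hc a self_mem_Ici).mono Ioi_subset_Ici_self)
  refine h1.congr' ?_
  filter_upwards [self_mem_nhdsWithin] with t ht
  exact (hu t ht).deriv.symm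

end ODE

/-! ### Hardy–Littlewood–Sobolev for the kernel `|t - s|^{-1/2}`. -/

/-- The Riesz kernel `|x|^{-1/2}` of the real line. -/
def rieszKernel (x : ℝ) : ℝ≥0∞ := ENNReal.ofReal (|x| ^ (-(1 / 2) : ℝ))

theorem measurable_rieszKernel : Measurable rieszKernel := by
  unfold rieszKernel; fun_prop

theorem rieszKernel_sub_comm (x y : ℝ) : rieszKernel (x - y) = rieszKernel (y - x) := by
  simp [rieszKernel, abs_sub_comm]

theorem lintegral_comp_abs (g : ℝ → ℝ≥0∞) : ∫⁻ x, g |x| = 2 * ∫⁻ x in Ioi 0, g x := by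
  have h1 : ∫⁻ x in Ioi (0 : ℝ), g |x| = ∫⁻ x in Ioi 0, g x :=
    setLIntegral_congr_fun measurableSet_Ioi fun x hx => by rw [abs_of_pos hx]
  have h2 : ∫⁻ x in Iio (0 : ℝ), g |x| = ∫⁻ x in Ioi 0, g x := by
    have := (Measure.measurePreserving_neg (volume : Measure ℝ)).setLIntegral_comp_preimage_emb
      (Homeomorph.neg ℝ).measurableEmbedding g (Ioi 0)
    rw [← this]
    simp only [neg_preimage, neg_Ioi, neg_zero]
    exact setLIntegral_congr_fun measurableSet_Iio fun x hx => by rw [abs_of_neg hx]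
  rw [← lintegral_add_compl _ measurableSet_Ioi (A := Ioi (0 : ℝ)), compl_Ioi,
    setLIntegral_congr Iio_ae_eq_Iic.symm, h1, h2, two_mul]

theorem lintegral_rieszKernel_near {δ : ℝ} (hδ : 0 < δ) :
    ∫⁻ x in {x : ℝ | |x| ≤ δ}, rieszKernel x = 4 * ENNReal.ofReal (δ ^ (1 / 2 : ℝ)) := by
  have hm : MeasurableSet {x : ℝ | |x| ≤ δ} := measurableSet_le (by fun_prop) (by fun_prop)
  have h1 := lintegral_comp_abs
    ((Iic δ).indicator fun y => ENNReal.ofReal (y ^ (-(1 / 2) : ℝ)))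
  have h2 : ∫⁻ x in {x : ℝ | |x| ≤ δ}, rieszKernel x
      = ∫⁻ x, ((Iic δ).indicator fun y => ENNReal.ofReal (y ^ (-(1 / 2) : ℝ))) |x| := by
    rw [← lintegral_indicator hm]
    rfl
  rw [h2, h1, setLIntegral_indicator measurableSet_Iic, Iic_inter_Ioi,
    ← ofReal_integral_eq_lintegral_ofReal]
  · rw [← intervalIntegral.integral_of_le hδ.le, integral_rpow (Or.inl (by norm_num)),
      show (4 : ℝ≥0∞) = 2 * 2 by norm_num, mul_assoc]
    congr 1
    rw [show (2 : ℝ≥0∞) = ENNReal.ofReal 2 by norm_num, ← ENNReal.ofReal_mul (by norm_num)]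
    congr 1
    norm_num
    ring
  · have := intervalIntegral.intervalIntegrable_rpow' (a := 0) (b := δ) (r := -(1 / 2))
      (by norm_num)
    exact (intervalIntegrable_iff_integrableOn_Ioc_of_le hδ.le).1 this
  · filter_upwards [ae_restrict_mem measurableSet_Ioc] with x hx
    exact Real.rpow_nonneg hx.1.le _

theorem lintegral_rieszKernel_far {δ : ℝ} (hδ : 0 < δ) :
    ∫⁻ x in {x : ℝ | |x| ≤ δ}ᶜ, rieszKernel x ^ (4 : ℝ) = 2 * ENNReal.ofReal (δ⁻¹) := by
  have hm : MeasurableSet {x : ℝ | |x| ≤ δ} := measurableSet_le (by fun_prop) (by fun_prop)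
  have h1 := lintegral_comp_abs
    ((Ioi δ).indicator fun y => ENNReal.ofReal (y ^ (-(1 / 2) : ℝ)) ^ (4 : ℝ))
  have h2 : ∫⁻ x in {x : ℝ | |x| ≤ δ}ᶜ, rieszKernel x ^ (4 : ℝ)
      = ∫⁻ x, ((Ioi δ).indicator fun y => ENNReal.ofReal (y ^ (-(1 / 2) : ℝ)) ^ (4 : ℝ)) |x| := by
    rw [← lintegral_indicator hm.compl]
    refine lintegral_congr fun x => ?_
    simp only [indicator, mem_compl_iff, mem_ofPred_eq, mem_Ioi, not_le]
    rfl
  rw [h2, h1, setLIntegral_indicator measurableSet_Ioi, Ioi_inter_Ioi, max_eq_left hδ.le]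
  have h3 : ∫⁻ y in Ioi δ, ENNReal.ofReal (y ^ (-(1 / 2) : ℝ)) ^ (4 : ℝ)
      = ∫⁻ y in Ioi δ, ENNReal.ofReal (y ^ (-2 : ℝ)) := by
    refine setLIntegral_congr_fun measurableSet_Ioi fun y hy => ?_
    have hy0 : (0 : ℝ) < y := hδ.trans hy
    rw [ENNReal.ofReal_rpow_of_nonneg (by positivity) (by norm_num), ← Real.rpow_mul hy0.le]
    norm_num
  rw [h3, ← ofReal_integral_eq_lintegral_ofReal
    (integrableOn_Ioi_rpow_of_lt (by norm_num) hδ), integral_Ioi_rpow_of_lt (by norm_num) hδ]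
  · norm_num [Real.rpow_neg_one]
  · filter_upwards [ae_restrict_mem measurableSet_Ioi] with x hx
    exact Real.rpow_nonneg (hδ.trans hx).le _

/-- Split at `|s - t| = δ`: nearby the truncation height `β` is used, far away Hölder with exponents
`4/3` and `4`. The choice `δ = a β^{-4/3}` balances `β δ^{1/2}` and `a^{3/4} δ^{-1/4}`, both equal
to `a^{1/2} β^{1/3}`. Without the truncation there would be no pointwise bound. -/
theorem lintegral_min_mul_rieszKernel_le {f : ℝ → ℝ≥0} (hf : Measurable f) {a : ℝ} (ha : 0 < a)
    (hfa : ∫⁻ s, (f s : ℝ≥0∞) ^ (4 / 3 : ℝ) = ENNReal.ofReal a) (β : ℝ≥0) (t : ℝ) :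
    ∫⁻ s, (min (f s) β : ℝ≥0) * rieszKernel (s - t)
      ≤ 6 * (ENNReal.ofReal a ^ (1 / 2 : ℝ) * (β : ℝ≥0∞) ^ (1 / 3 : ℝ)) := by
  rcases eq_or_ne β 0 with rfl | hβ
  · simp
  have hb : (0 : ℝ) < β := by positivity
  set b : ℝ := (β : ℝ) with hbdef
  have hβb : (β : ℝ≥0∞) = ENNReal.ofReal b := by simp [hbdef]
  set g : ℝ → ℝ≥0 := fun s => f (s + t)
  have hg : Measurable g := hf.comp (measurable_add_const t)
  have hga : ∫⁻ s, (g s : ℝ≥0∞) ^ (4 / 3 : ℝ) = ENNReal.ofReal a := by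
    rw [← hfa]
    exact lintegral_add_right_eq_self (fun s => (f s : ℝ≥0∞) ^ (4 / 3 : ℝ)) t
  have htr : ∫⁻ s, (min (f s) β : ℝ≥0) * rieszKernel (s - t)
      = ∫⁻ s, (min (g s) β : ℝ≥0) * rieszKernel s := by
    rw [← lintegral_add_right_eq_self
      (fun s => ((min (f s) β : ℝ≥0) : ℝ≥0∞) * rieszKernel (s - t)) t]
    simp [g]
  set δ : ℝ := a * b ^ (-(4 / 3) : ℝ) with hδdef
  have hδ : 0 < δ := by positivity
  have hm : MeasurableSet {x : ℝ | |x| ≤ δ} := measurableSet_le (by fun_prop) (by fun_prop)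
  have e1 : b * δ ^ (1 / 2 : ℝ) = a ^ (1 / 2 : ℝ) * b ^ (1 / 3 : ℝ) := by
    rw [hδdef, Real.mul_rpow ha.le (by positivity), ← Real.rpow_mul hb.le, mul_left_comm]
    congr 1
    nth_rewrite 1 [← Real.rpow_one b]
    rw [← Real.rpow_add hb]
    norm_num
  have e2 : a ^ (3 / 4 : ℝ) * (2 * δ⁻¹) ^ (1 / 4 : ℝ)
      ≤ 2 * (a ^ (1 / 2 : ℝ) * b ^ (1 / 3 : ℝ)) := by
    have h2 : (2 : ℝ) ^ (1 / 4 : ℝ) ≤ 2 := by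
      calc (2 : ℝ) ^ (1 / 4 : ℝ) ≤ 2 ^ (1 : ℝ) :=
            Real.rpow_le_rpow_of_exponent_le (by norm_num) (by norm_num)
        _ = 2 := Real.rpow_one _
    have h3 : a ^ (3 / 4 : ℝ) * (δ⁻¹) ^ (1 / 4 : ℝ) = a ^ (1 / 2 : ℝ) * b ^ (1 / 3 : ℝ) := by
      rw [hδdef, ← Real.rpow_neg_one, ← Real.rpow_mul (by positivity),
        Real.mul_rpow ha.le (by positivity), ← Real.rpow_mul hb.le, ← mul_assoc,
        ← Real.rpow_add ha]
      norm_num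
    rw [Real.mul_rpow (by norm_num) (by positivity), mul_left_comm, h3]
    gcongr
  have near : ∫⁻ s in {x : ℝ | |x| ≤ δ}, (min (g s) β : ℝ≥0) * rieszKernel s
      ≤ 4 * ENNReal.ofReal (a ^ (1 / 2 : ℝ) * b ^ (1 / 3 : ℝ)) := by
    calc _ ≤ ∫⁻ s in {x : ℝ | |x| ≤ δ}, (β : ℝ≥0∞) * rieszKernel s := by
          refine lintegral_mono fun s => ?_
          gcongr
          exact min_le_right _ _
      _ = 4 * ENNReal.ofReal (b * δ ^ (1 / 2 : ℝ)) := by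
          rw [lintegral_const_mul _ measurable_rieszKernel, lintegral_rieszKernel_near hδ, hβb,
            ENNReal.ofReal_mul hb.le]
          ring
      _ = _ := by rw [e1]
  have far : ∫⁻ s in {x : ℝ | |x| ≤ δ}ᶜ, (min (g s) β : ℝ≥0) * rieszKernel s
      ≤ 2 * ENNReal.ofReal (a ^ (1 / 2 : ℝ) * b ^ (1 / 3 : ℝ)) := by
    have hconj : (4 / 3 : ℝ).HolderConjugate 4 := by
      rw [Real.holderConjugate_iff]; norm_num
    calc _ ≤ ∫⁻ s in {x : ℝ | |x| ≤ δ}ᶜ, ((fun s => (g s : ℝ≥0∞)) * rieszKernel) s := by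
          refine lintegral_mono fun s => ?_
          simp only [Pi.mul_apply]
          gcongr
          exact min_le_left _ _
      _ ≤ (∫⁻ s in {x : ℝ | |x| ≤ δ}ᶜ, (g s : ℝ≥0∞) ^ (4 / 3 : ℝ)) ^ (1 / (4 / 3) : ℝ)
          * (∫⁻ s in {x : ℝ | |x| ≤ δ}ᶜ, rieszKernel s ^ (4 : ℝ)) ^ (1 / 4 : ℝ) :=
          ENNReal.lintegral_mul_le_Lp_mul_Lq _ hconj hg.coe_nnreal_ennreal.aemeasurable
            measurable_rieszKernel.aemeasurable
      _ ≤ (ENNReal.ofReal a) ^ (3 / 4 : ℝ) * (2 * ENNReal.ofReal δ⁻¹) ^ (1 / 4 : ℝ) := by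
          rw [lintegral_rieszKernel_far hδ, show (1 / (4 / 3) : ℝ) = 3 / 4 by norm_num, ← hga]
          gcongr
          exact Measure.restrict_le_self
      _ = ENNReal.ofReal (a ^ (3 / 4 : ℝ) * (2 * δ⁻¹) ^ (1 / 4 : ℝ)) := by
          rw [show (2 : ℝ≥0∞) = ENNReal.ofReal 2 by norm_num, ← ENNReal.ofReal_mul (by norm_num),
            ENNReal.ofReal_rpow_of_nonneg ha.le (by norm_num),
            ENNReal.ofReal_rpow_of_nonneg (by positivity) (by norm_num),
            ← ENNReal.ofReal_mul (by positivity)]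
      _ ≤ ENNReal.ofReal (2 * (a ^ (1 / 2 : ℝ) * b ^ (1 / 3 : ℝ))) := ENNReal.ofReal_le_ofReal e2
      _ = _ := by rw [ENNReal.ofReal_mul (by norm_num)]; norm_num
  rw [htr, ← lintegral_add_compl _ hm, hβb, ENNReal.ofReal_rpow_of_nonneg ha.le (by norm_num),
    ENNReal.ofReal_rpow_of_nonneg hb.le (by norm_num), ← ENNReal.ofReal_mul (by positivity)]
  refine (add_le_add near far).trans (le_of_eq ?_)
  rw [← add_mul]
  norm_num

/-- The Hardy–Littlewood–Sobolev inequality for the kernel `|t - s|^{-1/2}` on the line, in its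
diagonal form. -/
theorem lintegral_lintegral_rieszKernel_le {f : ℝ → ℝ≥0} (hf : Measurable f) :
    ∫⁻ t, ∫⁻ s, (f t : ℝ≥0∞) * f s * rieszKernel (s - t)
      ≤ 12 * (∫⁻ s, (f s : ℝ≥0∞) ^ (4 / 3 : ℝ)) ^ (3 / 2 : ℝ) := by
  have hfE : Measurable fun s => (f s : ℝ≥0∞) := hf.coe_nnreal_ennreal
  set I := ∫⁻ s, (f s : ℝ≥0∞) ^ (4 / 3 : ℝ) with hI
  rcases eq_or_ne I 0 with h0 | h0
  · have hae : ∀ᵐ t, (f t : ℝ≥0∞) = 0 := by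
      rw [hI, lintegral_eq_zero_iff (hfE.pow_const _)] at h0
      filter_upwards [h0] with t ht
      simpa using ht
    rw [lintegral_congr_ae (g := fun _ => 0)]
    · simp
    · filter_upwards [hae] with t ht
      simp [ht]
  rcases eq_or_ne I ∞ with h1 | h1
  · rw [h1, ENNReal.top_rpow_of_pos (by norm_num), ENNReal.mul_top (by norm_num)]
    exact le_top
  have ha : 0 < I.toReal := ENNReal.toReal_pos h0 h1
  have hIa : I = ENNReal.ofReal I.toReal := (ENNReal.ofReal_toReal h1).symm
  have key := fun t => lintegral_min_mul_rieszKernel_le hf ha (hI.symm.trans hIa) (f t) t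
  rw [← hIa] at key
  -- A product is its maximum times its minimum, so `f(t) f(s) ≤ (f(t) + f(s)) min(f(s), f(t))`. By
  -- symmetry it suffices to truncate `f(s)` at height `f(t)`, and the pointwise bound then produces
  -- `f(t) · f(t)^{1/3} = f(t)^{4/3}`.
  set G : ℝ → ℝ → ℝ≥0∞ := fun t s => (f t : ℝ≥0∞) * ((min (f s) (f t) : ℝ≥0) * rieszKernel (s - t))
  have hk : Measurable fun q : ℝ × ℝ => rieszKernel (q.2 - q.1) :=
    measurable_rieszKernel.comp (measurable_snd.sub measurable_fst)
  have hG : Measurable (Function.uncurry G) := by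
    have h1 : Measurable fun q : ℝ × ℝ => ((f q.1 : ℝ≥0) : ℝ≥0∞) := hfE.comp measurable_fst
    have h2 : Measurable fun q : ℝ × ℝ => ((min (f q.2) (f q.1) : ℝ≥0) : ℝ≥0∞) :=
      ((hf.comp measurable_snd).min (hf.comp measurable_fst)).coe_nnreal_ennreal
    exact h1.mul (h2.mul hk)
  have hGle : ∫⁻ t, ∫⁻ s, G t s ≤ 6 * I ^ (3 / 2 : ℝ) := by
    calc ∫⁻ t, ∫⁻ s, G t s
        ≤ ∫⁻ t, (6 * I ^ (1 / 2 : ℝ)) * (f t : ℝ≥0∞) ^ (4 / 3 : ℝ) := by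
          refine lintegral_mono fun t => ?_
          have hm : Measurable fun s => ((min (f s) (f t) : ℝ≥0) : ℝ≥0∞) * rieszKernel (s - t) :=
            (hf.min measurable_const).coe_nnreal_ennreal.mul
              (measurable_rieszKernel.comp (measurable_id.sub_const t))
          simp only [G]
          rw [lintegral_const_mul _ hm]
          refine (mul_le_mul_right (key t) _).trans (le_of_eq ?_)
          have : (f t : ℝ≥0∞) ^ (4 / 3 : ℝ) = f t * (f t : ℝ≥0∞) ^ (1 / 3 : ℝ) := by
            nth_rewrite 2 [← ENNReal.rpow_one (f t : ℝ≥0∞)]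
            rw [← ENNReal.rpow_add_of_nonneg _ _ (by norm_num) (by norm_num)]
            norm_num
          rw [this]
          ring
      _ = 6 * I ^ (3 / 2 : ℝ) := by
          rw [lintegral_const_mul _ (hfE.pow_const _), ← hI, mul_assoc]
          congr 1
          nth_rewrite 2 [← ENNReal.rpow_one I]
          rw [← ENNReal.rpow_add_of_nonneg _ _ (by norm_num) (by norm_num)]
          norm_num
  calc ∫⁻ t, ∫⁻ s, (f t : ℝ≥0∞) * f s * rieszKernel (s - t)
      ≤ ∫⁻ t, ∫⁻ s, (G t s + G s t) := by
        refine lintegral_mono fun t => lintegral_mono fun s => ?_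
        simp only [G]
        rw [rieszKernel_sub_comm t s, ← mul_assoc, ← mul_assoc, ← add_mul]
        gcongr
        norm_cast
        rcases le_total (f t) (f s) with h | h
        · rw [min_eq_left h, mul_comm]
          exact le_add_self
        · rw [min_eq_left h]
          exact le_self_add
    _ = (∫⁻ t, ∫⁻ s, G t s) + ∫⁻ t, ∫⁻ s, G s t := by
        rw [← lintegral_add_left (f := fun t => ∫⁻ s, G t s) hG.lintegral_prod_right']
        refine lintegral_congr fun t => ?_
        exact lintegral_add_left (hG.comp measurable_prodMk_left) _
    _ = (∫⁻ t, ∫⁻ s, G t s) + ∫⁻ t, ∫⁻ s, G t s := by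
        congr 1
        exact lintegral_lintegral_swap (f := fun t s => G s t) (hG.comp measurable_swap).aemeasurable
    _ ≤ 6 * I ^ (3 / 2 : ℝ) + 6 * I ^ (3 / 2 : ℝ) := add_le_add hGle hGle
    _ = 12 * I ^ (3 / 2 : ℝ) := by rw [← add_mul]; norm_num

/-! ### Dual Strichartz estimate for a dissipative generator. -/

section Duality

open NormedSpace ContinuousLinearMap

variable {E : Type*} [NormedAddCommGroup E] [InnerProductSpace ℝ E] [CompleteSpace E]

/-- The solution of the backward adjoint problem `w' = -B† w - F`, `w(b) = 0`. -/
def backwardSolution (B : E →L[ℝ] E) (F : ℝ → E) (b t : ℝ) : E :=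
  exp ((-t) • adjoint B) (∫ s in t..b, exp (s • adjoint B) (F s))

theorem exp_neg_smul_exp_smul (C : E →L[ℝ] E) (s t : ℝ) (x : E) :
    exp ((-s) • C) (exp (t • C) x) = exp ((t - s) • C) x := by
  let _ : NormedAlgebra ℚ (E →L[ℝ] E) := NormedAlgebra.restrictScalars ℚ ℝ (E →L[ℝ] E)
  have : exp ((-s) • C) * exp (t • C) = exp ((t - s) • C) := by
    rw [← exp_add_of_commute (((Commute.refl C).smul_left _).smul_right _), ← add_smul,
      neg_add_eq_sub]
  rw [← this]
  rfl

theorem continuous_exp_smul (C : E →L[ℝ] E) : Continuous fun t : ℝ => exp (t • C) :=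
  continuous_iff_continuousAt.2 fun t => (hasDerivAt_exp_smul_const' C t).continuousAt

theorem adjoint_exp_smul (B : E →L[ℝ] E) (t : ℝ) :
    adjoint (exp (t • B)) = exp (t • adjoint B) := by
  have := star_exp (t • B)
  rw [star_eq_adjoint, star_smul, star_eq_adjoint] at this
  simpa using this

variable {B : E →L[ℝ] E} {F : ℝ → E}

theorem backwardSolution_self (b : ℝ) : backwardSolution B F b b = 0 := by
  simp [backwardSolution]

theorem hasDerivAt_backwardSolution (hF : Continuous F) (b t : ℝ) :
    HasDerivAt (backwardSolution B F b) (-adjoint B (backwardSolution B F b t) - F t) t := by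
  have hc : Continuous fun s : ℝ => exp (s • adjoint B) (F s) :=
    (continuous_exp_smul _).clm_apply hF
  have hg : HasDerivAt (fun t => ∫ s in t..b, exp (s • adjoint B) (F s))
      (-exp (t • adjoint B) (F t)) t := by
    have := (hc.integral_hasStrictDerivAt b t).hasDerivAt.neg
    refine this.congr_of_eventuallyEq (.of_forall fun s => ?_)
    exact intervalIntegral.integral_symm _ _
  have hE : HasDerivAt (fun t : ℝ => exp ((-t) • adjoint B))
      (-(adjoint B * exp ((-t) • adjoint B))) t := by
    have h := (hasDerivAt_exp_smul_const' (adjoint B) (-t)).scomp t (hasDerivAt_neg t)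
    rw [neg_one_smul] at h
    exact h
  refine (hE.clm_apply hg).congr_deriv ?_
  have h1 := exp_neg_smul_exp_smul (adjoint B) t t (F t)
  rw [sub_self, zero_smul, exp_zero] at h1
  rw [map_neg, h1, neg_apply]
  exact (sub_eq_add_neg _ _).symm

theorem continuous_backwardSolution (hF : Continuous F) (b : ℝ) :
    Continuous (backwardSolution B F b) :=
  continuous_iff_continuousAt.2 fun t => (hasDerivAt_backwardSolution hF b t).continuousAt

/-- Moving the adjoint exponentials to the other side leaves only the forward propagator at times `r
- s`, which for `s < r` is where the dispersive bound is available. -/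
theorem inner_backwardSolution (hF : Continuous F) (b s : ℝ) (x : E) :
    inner ℝ (backwardSolution B F b s) x
      = ∫ r in s..b, inner ℝ (F r) (exp ((r - s) • B) x) := by
  have hc : Continuous fun r : ℝ => exp (r • adjoint B) (F r) :=
    (continuous_exp_smul _).clm_apply hF
  rw [real_inner_comm, backwardSolution]
  have := ((innerSL ℝ x).comp (exp ((-s) • adjoint B))).intervalIntegral_comp_comm
    (μ := volume) (hc.intervalIntegrable s b)
  simp only [comp_apply, innerSL_apply_apply] at this
  rw [← this]
  refine intervalIntegral.integral_congr fun r _ => ?_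
  simp only [exp_neg_smul_exp_smul]
  rw [← adjoint_exp_smul, adjoint_inner_right, real_inner_comm]

/-- Energy identity: `d/ds ‖w‖² = -2⟪Bw, w⟫ - 2⟪w, F⟫ ≥ -2⟪w, F⟫`, integrated up to `b`, where `w`
vanishes. -/
theorem norm_sq_backwardSolution_le (hB : ∀ x, inner ℝ (B x) x ≤ 0) (hF : Continuous F)
    {b t : ℝ} (htb : t ≤ b) :
    ‖backwardSolution B F b t‖ ^ 2
      ≤ 2 * ∫ s in t..b, inner ℝ (backwardSolution B F b s) (F s) := by
  set w := backwardSolution B F b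
  have hw : Continuous w := continuous_backwardSolution hF b
  have hd := fun s => (hasDerivAt_backwardSolution (B := B) hF b s).norm_sq
  have hc : Continuous fun s => 2 * inner ℝ (w s) (-adjoint B (w s) - F s) := by fun_prop
  have hc2 : Continuous fun s => inner ℝ (w s) (F s) := by fun_prop
  have hint := intervalIntegral.integral_eq_sub_of_hasDerivAt (a := t) (b := b)
    (fun s _ => hd s) (hc.intervalIntegrable _ _)
  rw [backwardSolution_self] at hint
  simp only [norm_zero] at hint
  have hle : ∫ s in t..b, -(2 * inner ℝ (w s) (F s))
      ≤ ∫ s in t..b, 2 * inner ℝ (w s) (-adjoint B (w s) - F s) := by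
    refine intervalIntegral.integral_mono_on htb
      ((hc2.const_mul 2).neg.intervalIntegrable _ _) (hc.intervalIntegrable _ _) fun s _ => ?_
    rw [inner_sub_right, inner_neg_right, adjoint_inner_right]
    linarith [hB (w s)]
  rw [intervalIntegral.integral_neg, intervalIntegral.integral_const_mul] at hle
  have : ∫ s in t..b, 2 * inner ℝ (w s) (-adjoint B (w s) - F s) = 0 ^ 2 - ‖w t‖ ^ 2 := hint
  nlinarith

/-- The `L^{4/3}(l¹) → L^∞(l²)` estimate for the backward problem. -/
theorem norm_sq_backwardSolution_le_of_dispersive (hB : ∀ x, inner ℝ (B x) x ≤ 0)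
    (hF : Continuous F) {n : ℝ → ℝ} (hn : Continuous n) (hn0 : ∀ t, 0 ≤ n t) {κ : ℝ} (hκ : 0 ≤ κ)
    (hdisp : ∀ s r, s < r →
      |inner ℝ (F r) (exp ((r - s) • B) (F s))| ≤ κ * (r - s) ^ (-(1 / 2) : ℝ) * (n r * n s))
    {a b t : ℝ} (hat : a ≤ t) (htb : t ≤ b) :
    ‖backwardSolution B F b t‖ ^ 2
      ≤ 24 * κ * (∫ s in a..b, n s ^ (4 / 3 : ℝ)) ^ (3 / 2 : ℝ) := by
  have hab := hat.trans htb
  set w := backwardSolution B F b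
  -- Extension by zero makes the inequality on the whole line applicable.
  set m : ℝ → ℝ≥0 := (Ioc a b).indicator fun s => (n s).toNNReal with hm
  have hmm : Measurable m := hn.measurable.real_toNNReal.indicator measurableSet_Ioc
  have hmI : ∫⁻ s, (m s : ℝ≥0∞) ^ (4 / 3 : ℝ)
      = ENNReal.ofReal (∫ s in a..b, n s ^ (4 / 3 : ℝ)) := by
    have hc : Continuous fun s => n s ^ (4 / 3 : ℝ) :=
      hn.rpow_const fun s => Or.inr (by norm_num)
    rw [intervalIntegral.integral_of_le hab, ofReal_integral_eq_lintegral_ofReal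
      ((intervalIntegrable_iff_integrableOn_Ioc_of_le hab).1 (hc.intervalIntegrable _ _))
      (.of_forall fun s => Real.rpow_nonneg (hn0 s) _), ← lintegral_indicator measurableSet_Ioc]
    refine lintegral_congr fun s => ?_
    by_cases hs : s ∈ Ioc a b
    · simp only [hm, indicator_of_mem hs]
      rw [← ENNReal.ofReal_rpow_of_nonneg (hn0 s) (by norm_num)]
      rfl
    · simp [hm, indicator_of_notMem hs]
  have h0 : 0 ≤ ∫ s in a..b, n s ^ (4 / 3 : ℝ) :=
    intervalIntegral.integral_nonneg hab fun s _ => Real.rpow_nonneg (hn0 s) _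
  have hinner : ∀ s ∈ Ioc t b, ‖inner ℝ (w s) (F s)‖ₑ
      ≤ ENNReal.ofReal κ * ∫⁻ r, (m s : ℝ≥0∞) * m r * rieszKernel (r - s) := by
    intro s hs
    have hmeas : Measurable fun r => (m s : ℝ≥0∞) * m r * rieszKernel (r - s) :=
      (hmm.coe_nnreal_ennreal.const_mul _).mul
        (measurable_rieszKernel.comp (measurable_id.sub_const s))
    rw [inner_backwardSolution hF, intervalIntegral.integral_of_le hs.2,
      ← lintegral_const_mul _ hmeas]
    refine (enorm_integral_le_lintegral_enorm _).trans ?_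
    rw [← lintegral_indicator measurableSet_Ioc]
    refine lintegral_mono fun r => ?_
    by_cases hr : r ∈ Ioc s b
    · rw [indicator_of_mem hr]
      have hrs : 0 < r - s := sub_pos.2 hr.1
      have h1 : m s = (n s).toNNReal := indicator_of_mem (show s ∈ Ioc a b from
        ⟨hat.trans_lt hs.1, hs.2⟩) _
      have h2 : m r = (n r).toNNReal := indicator_of_mem (show r ∈ Ioc a b from
        ⟨(hat.trans_lt hs.1).trans hr.1, hr.2⟩) _
      rw [h1, h2, rieszKernel, abs_of_pos hrs]
      change _ ≤ ENNReal.ofReal κ * (ENNReal.ofReal (n s) * ENNReal.ofReal (n r) * _)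
      rw [← ENNReal.ofReal_mul (hn0 s), ← ENNReal.ofReal_mul (mul_nonneg (hn0 s) (hn0 r)),
        ← ENNReal.ofReal_mul hκ, ← ofReal_norm, Real.norm_eq_abs]
      refine ENNReal.ofReal_le_ofReal ((hdisp s r hr.1).trans (le_of_eq ?_))
      ring
    · rw [indicator_of_notMem hr]
      exact zero_le
  have hmeas2 : Measurable fun s => ∫⁻ r, (m s : ℝ≥0∞) * m r * rieszKernel (r - s) := by
    have : Measurable fun q : ℝ × ℝ => (m q.1 : ℝ≥0∞) * m q.2 * rieszKernel (q.2 - q.1) :=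
      ((hmm.coe_nnreal_ennreal.comp measurable_fst).mul
        (hmm.coe_nnreal_ennreal.comp measurable_snd)).mul
        (measurable_rieszKernel.comp (measurable_snd.sub measurable_fst))
    exact this.lintegral_prod_right'
  have hmain : ENNReal.ofReal (∫ s in t..b, inner ℝ (w s) (F s))
      ≤ ENNReal.ofReal (12 * κ * (∫ s in a..b, n s ^ (4 / 3 : ℝ)) ^ (3 / 2 : ℝ)) := by
    calc ENNReal.ofReal (∫ s in t..b, inner ℝ (w s) (F s))
        ≤ ‖∫ s in t..b, inner ℝ (w s) (F s)‖ₑ := by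
          rw [← ofReal_norm]; exact ENNReal.ofReal_le_ofReal (Real.le_norm_self _)
      _ ≤ ∫⁻ s in Ioc t b, ‖inner ℝ (w s) (F s)‖ₑ := by
          rw [intervalIntegral.integral_of_le htb]
          exact enorm_integral_le_lintegral_enorm _
      _ ≤ ∫⁻ s in Ioc t b,
            ENNReal.ofReal κ * ∫⁻ r, (m s : ℝ≥0∞) * m r * rieszKernel (r - s) :=
          setLIntegral_mono' measurableSet_Ioc hinner
      _ ≤ ∫⁻ s, ENNReal.ofReal κ * ∫⁻ r, (m s : ℝ≥0∞) * m r * rieszKernel (r - s) :=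
          setLIntegral_le_lintegral _ _
      _ ≤ ENNReal.ofReal κ *
            (12 * (∫⁻ s, (m s : ℝ≥0∞) ^ (4 / 3 : ℝ)) ^ (3 / 2 : ℝ)) := by
          rw [lintegral_const_mul _ hmeas2]
          gcongr
          exact lintegral_lintegral_rieszKernel_le hmm
      _ = _ := by
          rw [hmI, ENNReal.ofReal_rpow_of_nonneg h0 (by norm_num),
            show (12 : ℝ≥0∞) = ENNReal.ofReal 12 by norm_num, ← ENNReal.ofReal_mul (by norm_num),
            ← ENNReal.ofReal_mul hκ]
          congr 1
          ring
  have := (ENNReal.ofReal_le_ofReal_iff (by positivity)).1 hmain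
  have h2 := norm_sq_backwardSolution_le hB hF htb
  linarith

/-- The dual form of the Strichartz estimate for `u' = B u + f`. -/
theorem integral_inner_le_of_dispersive (hB : ∀ x, inner ℝ (B x) x ≤ 0)
    (hF : Continuous F) {n : ℝ → ℝ} (hn : Continuous n) (hn0 : ∀ t, 0 ≤ n t) {κ : ℝ} (hκ : 0 ≤ κ)
    (hdisp : ∀ s r, s < r →
      |inner ℝ (F r) (exp ((r - s) • B) (F s))| ≤ κ * (r - s) ^ (-(1 / 2) : ℝ) * (n r * n s))
    {u f : ℝ → E} (hf : Continuous f) (hu : ∀ t, HasDerivAt u (B (u t) + f t) t)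
    {a b : ℝ} (hab : a ≤ b) :
    ∫ t in a..b, inner ℝ (F t) (u t)
      ≤ √(24 * κ) * (∫ s in a..b, n s ^ (4 / 3 : ℝ)) ^ (3 / 4 : ℝ)
        * (‖u a‖ + ∫ t in a..b, ‖f t‖) := by
  set w := backwardSolution B F b
  set W := √(24 * κ) * (∫ s in a..b, n s ^ (4 / 3 : ℝ)) ^ (3 / 4 : ℝ) with hW
  have h0 : 0 ≤ ∫ s in a..b, n s ^ (4 / 3 : ℝ) :=
    intervalIntegral.integral_nonneg hab fun s _ => Real.rpow_nonneg (hn0 s) _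
  have hwW : ∀ t ∈ Icc a b, ‖w t‖ ≤ W := by
    intro t ht
    refine le_of_sq_le_sq ?_ (by positivity)
    refine (norm_sq_backwardSolution_le_of_dispersive hB hF hn hn0 hκ hdisp ht.1 ht.2).trans
      (le_of_eq ?_)
    rw [hW, mul_pow, Real.sq_sqrt (by positivity), ← Real.rpow_natCast, ← Real.rpow_mul h0]
    norm_num
  have hwc : Continuous w := continuous_backwardSolution hF b
  have huc : Continuous u := continuous_iff_continuousAt.2 fun t => (hu t).continuousAt
  -- The terms with `B` cancel in the pairing with the adjoint problem, so only the two sources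
  -- remain.
  have hd : ∀ t, HasDerivAt (fun t => inner ℝ (w t) (u t))
      (inner ℝ (w t) (f t) - inner ℝ (F t) (u t)) t := by
    intro t
    refine ((hasDerivAt_backwardSolution hF b t).inner ℝ (hu t)).congr_deriv ?_
    rw [inner_add_right, inner_sub_left, inner_neg_left, adjoint_inner_left]
    ring
  have hc1 : Continuous fun t => inner ℝ (w t) (f t) := by fun_prop
  have hc2 : Continuous fun t => inner ℝ (F t) (u t) := by fun_prop
  have hint := intervalIntegral.integral_eq_sub_of_hasDerivAt (a := a) (b := b)
    (fun s _ => hd s) ((hc1.sub hc2).intervalIntegrable _ _)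
  rw [intervalIntegral.integral_sub (hc1.intervalIntegrable _ _) (hc2.intervalIntegrable _ _),
    show w b = 0 from backwardSolution_self b, inner_zero_left] at hint
  have h1 : inner ℝ (w a) (u a) ≤ W * ‖u a‖ :=
    (real_inner_le_norm _ _).trans (by gcongr; exact hwW a ⟨le_rfl, hab⟩)
  have h2 : ∫ t in a..b, inner ℝ (w t) (f t) ≤ W * ∫ t in a..b, ‖f t‖ := by
    rw [← intervalIntegral.integral_const_mul]
    refine intervalIntegral.integral_mono_on hab (hc1.intervalIntegrable _ _)
      ((hf.norm.const_mul W).intervalIntegrable _ _) fun t ht => ?_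
    exact (real_inner_le_norm _ _).trans (by gcongr; exact hwW t ht)
  rw [mul_add]
  linarith

end Duality

/-! ### The power nonlinearity and the vector field on `l²`. -/

theorem norm_apply_le (x : GridL2) (j : ℤ) : ‖x j‖ ≤ ‖x‖ :=
  lp.norm_apply_le_norm (by norm_num) x j

theorem norm_le_of_forall_norm_apply_le {x y : GridL2} {c : ℝ} (hc : 0 ≤ c)
    (h : ∀ j, ‖x j‖ ≤ c * ‖y j‖) : ‖x‖ ≤ c * ‖y‖ := by
  have : ‖x‖ ≤ ‖c • y‖ := lp.norm_mono (by norm_num) fun j => by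
    rw [lp.coeFn_smul, Pi.smul_apply, norm_smul, Real.norm_of_nonneg hc]
    exact h j
  rwa [norm_smul, Real.norm_of_nonneg hc] at this

theorem memlp_norm_rpow_mul {p : ℝ} (hp : 0 ≤ p) (x : GridL2) :
    Memℓp (fun j => ((‖x j‖ ^ p : ℝ) : ℂ) * x j) 2 := by
  refine Memℓp.mono' (lp.memℓp (((‖x‖ ^ p : ℝ) : ℂ) • x)) fun j => ?_
  simp only [lp.coeFn_smul, Pi.smul_apply, smul_eq_mul, norm_mul, Complex.norm_real]
  rw [Real.norm_of_nonneg (by positivity), Real.norm_of_nonneg (by positivity)]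
  gcongr
  exact norm_apply_le x j

/-- The power nonlinearity `u ↦ |u|^p u` of `l²`. -/
def powerNonlinearity {p : ℝ} (hp : 0 ≤ p) (x : GridL2) : GridL2 :=
  ⟨fun j => ((‖x j‖ ^ p : ℝ) : ℂ) * x j, memlp_norm_rpow_mul hp x⟩

theorem powerNonlinearity_apply {p : ℝ} (hp : 0 ≤ p) (x : GridL2) (j : ℤ) :
    powerNonlinearity hp x j = ((‖x j‖ ^ p : ℝ) : ℂ) * x j := rfl

/-- Bernoulli's inequality for `(b/a)^{p+1}`. The factor `b` on the left matters when `p < 1`, since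
`x^p` is then not Lipschitz at `0`. -/
theorem rpow_sub_rpow_mul_le {p : ℝ} (hp : 0 ≤ p) {a b : ℝ} (hb : 0 ≤ b) (hab : b ≤ a) :
    (a ^ p - b ^ p) * b ≤ (p + 1) * a ^ p * (a - b) := by
  rcases hb.eq_or_lt with rfl | hb'
  · rw [mul_zero]; positivity
  have ha : 0 < a := hb'.trans_le hab
  have h1 := one_add_mul_self_le_rpow_one_add (s := b / a - 1)
    (by have : 0 ≤ b / a := by positivity
        linarith) (p := p + 1) (by linarith)
  rw [add_sub_cancel, Real.div_rpow hb ha.le, le_div_iff₀ (by positivity),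
    Real.rpow_add_one hb'.ne', Real.rpow_add_one ha.ne'] at h1
  have h2 : (1 + (p + 1) * (b / a - 1)) * (a ^ p * a)
      = a ^ p * a + (p + 1) * a ^ p * (b - a) := by
    field_simp
  have h3 : a ^ p * b ≤ a ^ p * a := by gcongr
  nlinarith

theorem norm_rpow_mul_sub_le {p : ℝ} (hp : 0 ≤ p) {R : ℝ} {z w : ℂ} (hz : ‖z‖ ≤ R) (hw : ‖w‖ ≤ R) :
    ‖((‖z‖ ^ p : ℝ) : ℂ) * z - ((‖w‖ ^ p : ℝ) : ℂ) * w‖ ≤ (p + 2) * R ^ p * ‖z - w‖ := by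
  wlog h : ‖w‖ ≤ ‖z‖ generalizing z w
  · rw [norm_sub_rev, norm_sub_rev z w]
    exact this hw hz (le_of_not_ge h)
  have e : ((‖z‖ ^ p : ℝ) : ℂ) * z - ((‖w‖ ^ p : ℝ) : ℂ) * w
      = ((‖z‖ ^ p : ℝ) : ℂ) * (z - w) + ((‖z‖ ^ p - ‖w‖ ^ p : ℝ) : ℂ) * w := by
    push_cast; ring
  have h1 : 0 ≤ ‖z‖ ^ p - ‖w‖ ^ p := by
    have : ‖w‖ ^ p ≤ ‖z‖ ^ p := by gcongr
    linarith
  have h2 := rpow_sub_rpow_mul_le hp (norm_nonneg w) h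
  have h3 : ‖z‖ - ‖w‖ ≤ ‖z - w‖ := norm_sub_norm_le z w
  have h4 : ‖z‖ ^ p ≤ R ^ p := by gcongr
  rw [e]
  refine (norm_add_le _ _).trans ?_
  rw [norm_mul, norm_mul, Complex.norm_real, Complex.norm_real,
    Real.norm_of_nonneg (by positivity), Real.norm_of_nonneg h1]
  calc _ ≤ ‖z‖ ^ p * ‖z - w‖ + (p + 1) * ‖z‖ ^ p * (‖z‖ - ‖w‖) := by gcongr
    _ ≤ ‖z‖ ^ p * ‖z - w‖ + (p + 1) * ‖z‖ ^ p * ‖z - w‖ := by gcongr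
    _ = (p + 2) * ‖z‖ ^ p * ‖z - w‖ := by ring
    _ ≤ _ := by gcongr

theorem norm_powerNonlinearity_sub_le {p : ℝ} (hp : 0 ≤ p) {R : ℝ} {x y : GridL2}
    (hx : ‖x‖ ≤ R) (hy : ‖y‖ ≤ R) :
    ‖powerNonlinearity hp x - powerNonlinearity hp y‖ ≤ (p + 2) * R ^ p * ‖x - y‖ := by
  have hR : 0 ≤ R := (norm_nonneg x).trans hx
  refine norm_le_of_forall_norm_apply_le (by positivity) fun j => ?_
  exact norm_rpow_mul_sub_le hp ((norm_apply_le x j).trans hx) ((norm_apply_le y j).trans hy)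

/-- The vector field `i A u - i |u|^p u` of the nonlinear Schrödinger equation. -/
def nlsField {p : ℝ} (hp : 0 ≤ p) (A : GridL2 →L[ℂ] GridL2) (x : GridL2) : GridL2 :=
  Complex.I • A x - Complex.I • powerNonlinearity hp x

theorem exists_lipschitzOn_nlsField {p : ℝ} (hp : 0 ≤ p) (A : GridL2 →L[ℂ] GridL2) (R : ℝ) :
    ∃ K : ℝ≥0, LipschitzOnWith K (nlsField hp A) (Metric.closedBall 0 R) := by
  refine ⟨(‖A‖ + (p + 2) * R ^ p).toNNReal, LipschitzOnWith.of_dist_le_mul fun x hx y hy => ?_⟩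
  have hx' : ‖x‖ ≤ R := by simpa using hx
  have hy' : ‖y‖ ≤ R := by simpa using hy
  have e : nlsField hp A x - nlsField hp A y
      = Complex.I • A (x - y) - Complex.I • (powerNonlinearity hp x - powerNonlinearity hp y) := by
    simp only [nlsField, map_sub, smul_sub]; abel
  rw [dist_eq_norm, dist_eq_norm, e]
  calc _ ≤ ‖A (x - y)‖ + ‖powerNonlinearity hp x - powerNonlinearity hp y‖ := by
        refine (norm_sub_le _ _).trans (le_of_eq ?_)
        simp [norm_smul]
    _ ≤ ‖A‖ * ‖x - y‖ + (p + 2) * R ^ p * ‖x - y‖ :=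
        add_le_add (A.le_opNorm _) (norm_powerNonlinearity_sub_le hp hx' hy')
    _ = (‖A‖ + (p + 2) * R ^ p) * ‖x - y‖ := by ring
    _ ≤ _ := by gcongr; exact Real.le_coe_toNNReal _

theorem inner_eq_re (x y : GridL2) : inner ℝ x y = (inner ℂ x y).re := by
  rw [lp.inner_eq_tsum, lp.inner_eq_tsum, Complex.re_tsum (lp.summable_inner x y)]
  rfl

theorem gridInner_eq (h : ℝ) (x y : GridL2) : gridInner h x y = h * inner ℝ x y := by
  rw [gridInner, Complex.re_ofReal_mul, real_inner_comm, inner_eq_re, lp.inner_eq_tsum]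
  rfl

/-- At each grid point the product is `i` times the real number `|x_j|^{p+2}`; hence the
nonlinearity drops out of every energy identity. -/
theorem inner_I_smul_powerNonlinearity {p : ℝ} (hp : 0 ≤ p) (x : GridL2) :
    inner ℝ x (Complex.I • powerNonlinearity hp x) = 0 := by
  rw [inner_eq_re, lp.inner_eq_tsum, Complex.re_tsum]
  · refine (tsum_congr fun j => ?_).trans tsum_zero
    simp only [lp.coeFn_smul, Pi.smul_apply, powerNonlinearity_apply, smul_eq_mul,
      RCLike.inner_apply]
    rw [show Complex.I * (((‖x j‖ ^ p : ℝ) : ℂ) * x j) * (starRingEnd ℂ) (x j)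
      = ((‖x j‖ ^ p : ℝ) : ℂ) * (Complex.I * (x j * (starRingEnd ℂ) (x j))) by ring,
      Complex.mul_conj]
    simp
  · exact lp.summable_inner x (Complex.I • powerNonlinearity hp x)

theorem inner_nlsField {p : ℝ} (hp : 0 ≤ p) (A : GridL2 →L[ℂ] GridL2) (x : GridL2) :
    inner ℝ x (nlsField hp A x) = inner ℝ x (Complex.I • A x) := by
  rw [nlsField, inner_sub_right, inner_I_smul_powerNonlinearity, sub_zero]

theorem abs_inner_nlsField_le {p : ℝ} (hp : 0 ≤ p) (A : GridL2 →L[ℂ] GridL2) (x : GridL2) :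
    |inner ℝ x (nlsField hp A x)| ≤ ‖A‖ * ‖x‖ ^ 2 := by
  rw [inner_nlsField]
  refine (abs_real_inner_le_norm _ _).trans ?_
  rw [norm_smul, Complex.norm_I, one_mul]
  calc ‖x‖ * ‖A x‖ ≤ ‖x‖ * (‖A‖ * ‖x‖) := by gcongr; exact A.le_opNorm x
    _ = _ := by ring

theorem eq_nlsField_iff {p : ℝ} (hp : 0 ≤ p) (A : GridL2 →L[ℂ] GridL2) (x y : GridL2) :
    (∀ j : ℤ, Complex.I * y j + A x j = ((‖x j‖ ^ p : ℝ) : ℂ) * x j) ↔ y = nlsField hp A x := by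
  have hI : Complex.I * Complex.I = -1 := Complex.I_mul_I
  constructor
  · intro H
    ext j
    have := H j
    simp only [nlsField, lp.coeFn_sub, lp.coeFn_smul, Pi.sub_apply, Pi.smul_apply, smul_eq_mul,
      powerNonlinearity_apply]
    rw [← this]
    linear_combination (y j) * hI
  · rintro rfl j
    simp only [nlsField, lp.coeFn_sub, lp.coeFn_smul, Pi.sub_apply, Pi.smul_apply, smul_eq_mul,
      powerNonlinearity_apply]
    linear_combination (A x j - ((‖x j‖ ^ p : ℝ) : ℂ) * x j) * hI

theorem IsSolutionOn.hasDerivAt {p : ℝ} (hp : 0 ≤ p) {A : GridL2 →L[ℂ] GridL2} {φ : GridL2}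
    {J : Set ℝ} {u : ℝ → GridL2} (h : IsSolutionOn p A φ J u) {t : ℝ} (ht : t ∈ interior J) :
    HasDerivAt u (nlsField hp A (u t)) t := by
  obtain ⟨u', h1, h2⟩ := h.equation t ht
  rwa [(eq_nlsField_iff hp A _ _).1 h2] at h1

theorem continuous_nlsField {p : ℝ} (hp : 0 ≤ p) (A : GridL2 →L[ℂ] GridL2) :
    Continuous (nlsField hp A) := by
  refine continuous_iff_continuousAt.2 fun x => ?_
  obtain ⟨K, hK⟩ := exists_lipschitzOn_nlsField hp A (‖x‖ + 1)
  refine hK.continuousOn.continuousAt ?_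
  refine Filter.mem_of_superset (Metric.ball_mem_nhds x one_pos) fun y hy => ?_
  rw [mem_closedBall_zero_iff]
  rw [Metric.mem_ball, dist_eq_norm] at hy
  have := norm_le_norm_add_norm_sub' y x
  linarith

/-! ### Well-posedness and the `l²` energy law. -/

theorem exists_isSolutionOn_univ {p : ℝ} (hp : 0 ≤ p) (A : GridL2 →L[ℂ] GridL2) (φ : GridL2) :
    ∃ u : ℝ → GridL2, IsSolutionOn p A φ univ u := by
  obtain ⟨u, h0, hu⟩ := exists_global_solution (exists_lipschitzOn_nlsField hp A) (norm_nonneg A)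
    (abs_inner_nlsField_le hp A) φ
  refine ⟨u, fun t _ => (hu t).continuousAt.continuousWithinAt, h0, fun t _ => ⟨_, hu t, ?_⟩⟩
  exact (eq_nlsField_iff hp A _ _).2 rfl

theorem IsSolutionOn.eq_of_univ {p : ℝ} (hp : 0 ≤ p) {A : GridL2 →L[ℂ] GridL2} {φ : GridL2}
    {u v : ℝ → GridL2} (hu : IsSolutionOn p A φ univ u) (hv : IsSolutionOn p A φ univ v) :
    v = u := by
  funext t
  have hmem : t ∈ Icc (-(|t| + 1)) (|t| + 1) :=
    abs_le.1 (by linarith)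
  refine eqOn_Icc_of_hasDerivAt (exists_lipschitzOn_nlsField hp A) (t₀ := 0) ?_
    (hv.continuousOn.mono (subset_univ _)) (hu.continuousOn.mono (subset_univ _))
    (fun s _ => hv.hasDerivAt hp (by simp)) (fun s _ => hu.hasDerivAt hp (by simp))
    (hv.initial.trans hu.initial.symm) hmem
  constructor <;> linarith [abs_nonneg t]

theorem IsSolutionOn.eqOn_Ici {p : ℝ} (hp : 0 ≤ p) {A : GridL2 →L[ℂ] GridL2} {φ : GridL2}
    {u v : ℝ → GridL2} (hu : IsSolutionOn p A φ univ u) (hv : IsSolutionOn p A φ (Ici 0) v) :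
    EqOn v u (Ici 0) := by
  intro t ht
  have hd : ∀ s ∈ Ioi (0 : ℝ), HasDerivAt v (nlsField hp A (v s)) s := fun s hs =>
    hv.hasDerivAt hp (by simpa using hs)
  refine eqOn_Icc_of_hasDerivWithinAt_right (exists_lipschitzOn_nlsField hp A)
    (hv.continuousOn.mono Icc_subset_Ici_self) (hu.continuousOn.mono (subset_univ _))
    (fun s hs => ?_) (fun s _ => (hu.hasDerivAt hp (by simp)).hasDerivWithinAt)
    (hv.initial.trans hu.initial.symm) (⟨ht, le_rfl⟩ : t ∈ Icc 0 t)
  -- At `0` the equation is not assumed on the half-line; the right derivative there is recovered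
  -- from continuity.
  rcases hs.1.eq_or_lt with rfl | h
  · exact hasDerivWithinAt_Ici_of_solution (continuous_nlsField hp A) hv.continuousOn hd
  · exact (hd s h).hasDerivWithinAt

theorem IsDissipative.inner_le {h : ℝ} (hh : 0 < h) {A : GridL2 →L[ℂ] GridL2}
    (hA : IsDissipative h A) (x : GridL2) : inner ℝ (Complex.I • A x) x ≤ 0 := by
  have := hA x
  rw [gridInner_eq] at this
  exact nonpos_of_mul_nonpos_right this hh

theorem IsConservative.inner_eq {h : ℝ} (hh : 0 < h) {A : GridL2 →L[ℂ] GridL2}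
    (hA : IsConservative h A) (x : GridL2) : inner ℝ (Complex.I • A x) x = 0 := by
  have := hA x
  rw [gridInner_eq] at this
  exact (mul_eq_zero.1 this).resolve_left hh.ne'

theorem norm_antitone_of_dissipative {p : ℝ} (hp : 0 ≤ p) {A : GridL2 →L[ℂ] GridL2}
    (hA : ∀ x, inner ℝ (Complex.I • A x) x ≤ 0) {u : ℝ → GridL2}
    (hu : ∀ t, HasDerivAt u (nlsField hp A (u t)) t) : Antitone fun t => ‖u t‖ := by
  have : Antitone fun t => ‖u t‖ ^ 2 := by
    refine antitone_of_hasDerivAt_nonpos (fun t => (hu t).norm_sq) fun t => ?_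
    change _ ≤ (0 : ℝ)
    rw [inner_nlsField, real_inner_comm]
    linarith [hA (u t)]
  exact fun s t hst => le_of_sq_le_sq (this hst) (norm_nonneg _)

theorem norm_eq_of_conservative {p : ℝ} (hp : 0 ≤ p) {A : GridL2 →L[ℂ] GridL2}
    (hA : ∀ x, inner ℝ (Complex.I • A x) x = 0) {u : ℝ → GridL2}
    (hu : ∀ t, HasDerivAt u (nlsField hp A (u t)) t) (s t : ℝ) : ‖u s‖ = ‖u t‖ := by
  have : ‖u s‖ ^ 2 = ‖u t‖ ^ 2 := by
    refine is_const_of_deriv_eq_zero (f := fun t => ‖u t‖ ^ 2)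
      (fun t => (hu t).norm_sq.differentiableAt) (fun t => ?_) s t
    rw [(hu t).norm_sq.deriv, inner_nlsField, real_inner_comm, hA, mul_zero]
  exact (sq_eq_sq₀ (norm_nonneg _) (norm_nonneg _)).1 this

/-! ### The dispersive estimate on finitely supported data. -/

/-- Restriction of scalars, from complex to real linear operators, as a ring homomorphism. -/
def realOperator : (GridL2 →L[ℂ] GridL2) →+* (GridL2 →L[ℝ] GridL2) where
  toFun A := A.restrictScalars ℝ
  map_one' := rfl
  map_mul' _ _ := rfl
  map_zero' := rfl
  map_add' _ _ := rfl

theorem exp_smul_realOperator_apply (A : GridL2 →L[ℂ] GridL2) (t : ℝ) (x : GridL2) :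
    NormedSpace.exp (t • realOperator (Complex.I • A)) x = propagator A t x := by
  let _ : NormedAlgebra ℚ (GridL2 →L[ℂ] GridL2) :=
    NormedAlgebra.restrictScalars ℚ ℂ (GridL2 →L[ℂ] GridL2)
  let _ : NormedAlgebra ℚ (GridL2 →L[ℝ] GridL2) :=
    NormedAlgebra.restrictScalars ℚ ℝ (GridL2 →L[ℝ] GridL2)
  have h := NormedSpace.map_exp realOperator
    (ContinuousLinearMap.continuous_restrictScalars ℝ) (((t : ℂ) * Complex.I) • A)
  have e : realOperator (((t : ℂ) * Complex.I) • A) = t • realOperator (Complex.I • A) := by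
    ext1 y
    change ((t : ℂ) * Complex.I) • A y = t • (Complex.I • A y)
    rw [mul_smul]
    rfl
  rw [e] at h
  rw [← h]
  rfl

/-- The finitely supported grid function with values `a j`, `j ∈ J`. -/
def finiteGrid (J : Finset ℤ) (a : ℤ → ℂ) : GridL2 := ∑ j ∈ J, lp.single 2 j (a j)

theorem finiteGrid_apply (J : Finset ℤ) (a : ℤ → ℂ) (k : ℤ) :
    finiteGrid J a k = if k ∈ J then a k else 0 := by
  simp only [finiteGrid, lp.coeFn_sum, Finset.sum_apply, lp.single_apply]
  rw [Finset.sum_pi_single]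

theorem inner_finiteGrid (J : Finset ℤ) (a : ℤ → ℂ) (x : GridL2) :
    inner ℝ (finiteGrid J a) x = ∑ j ∈ J, inner ℝ (a j) (x j) := by
  rw [finiteGrid, sum_inner]
  exact Finset.sum_congr rfl fun j _ => lp.inner_single_left j (a j) x

theorem gridNorm_one_finiteGrid {h : ℝ} (hh : 0 ≤ h) (J : Finset ℤ) (a : ℤ → ℂ) :
    gridNorm h 1 (fun j => finiteGrid J a j) = ENNReal.ofReal (h * ∑ j ∈ J, ‖a j‖) := by
  rw [gridNorm_eq_tsum h one_ne_zero ENNReal.one_ne_top, tsum_eq_sum (s := J)]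
  · simp only [ENNReal.toReal_one, ENNReal.rpow_one, div_one]
    rw [ENNReal.ofReal_mul hh, ENNReal.ofReal_sum_of_nonneg fun j _ => norm_nonneg _]
    congr 1
    refine Finset.sum_congr rfl fun j hj => ?_
    rw [finiteGrid_apply, if_pos hj, ofReal_norm]
  · intro j hj
    rw [finiteGrid_apply, if_neg hj]
    simp

/-- The factor `h` comes from the weight in the `l¹(hℤ)` norm; finite support makes that norm
finite. -/
theorem IsDispersive.norm_apply_le {h K : ℝ} (hh : 0 < h) (hK : 0 < K)
    {A : GridL2 →L[ℂ] GridL2} (hA : IsDispersive h K A) {t : ℝ} (ht : 0 < t) (J : Finset ℤ)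
    (a : ℤ → ℂ) (k : ℤ) :
    ‖propagator A t (finiteGrid J a) k‖ ≤ h * K * t ^ (-(1 / 2) : ℝ) * ∑ j ∈ J, ‖a j‖ := by
  have h1 := hA t ht (finiteGrid J a) (by
    rw [gridNorm_one_finiteGrid hh.le]; exact ENNReal.ofReal_lt_top)
  have hs : 0 ≤ ∑ j ∈ J, ‖a j‖ := Finset.sum_nonneg fun _ _ => norm_nonneg _
  rw [gridNorm_one_finiteGrid hh.le, gridNorm_top hh, ← ENNReal.ofReal_mul (by positivity)] at h1
  have h2 := (le_iSup (fun j => ‖propagator A t (finiteGrid J a) j‖ₑ) k).trans h1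
  rw [← ofReal_norm, ENNReal.ofReal_le_ofReal_iff (by positivity)] at h2
  refine h2.trans (le_of_eq ?_)
  rw [Real.rpow_neg ht.le]
  ring

theorem IsDispersive.abs_inner_le {h K : ℝ} (hh : 0 < h) (hK : 0 < K)
    {A : GridL2 →L[ℂ] GridL2} (hA : IsDispersive h K A) {t : ℝ} (ht : 0 < t) (J : Finset ℤ)
    (a b : ℤ → ℂ) :
    |inner ℝ (finiteGrid J b) (propagator A t (finiteGrid J a))|
      ≤ h * K * t ^ (-(1 / 2) : ℝ) * ((∑ j ∈ J, ‖b j‖) * ∑ j ∈ J, ‖a j‖) := by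
  rw [inner_finiteGrid]
  refine (Finset.abs_sum_le_sum_abs _ _).trans ?_
  calc _ ≤ ∑ k ∈ J, ‖b k‖ * (h * K * t ^ (-(1 / 2) : ℝ) * ∑ j ∈ J, ‖a j‖) := by
        refine Finset.sum_le_sum fun k _ => (abs_real_inner_le_norm _ _).trans ?_
        gcongr
        exact hA.norm_apply_le hh hK ht J a k
    _ = _ := by rw [← Finset.sum_mul]; ring

/-! ### Continuous test functions dual to the maximum norm. -/

/-- The maximum of `|x j|` over `j ∈ J`. -/
def maxNorm (J : Finset ℤ) (x : GridL2) : ℝ≥0 := J.sup fun j => ‖x j‖₊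

theorem continuous_apply (j : ℤ) : Continuous fun x : GridL2 => x j :=
  (lp.evalCLM ℂ (fun _ : ℤ => ℂ) 2 j).continuous

theorem continuous_maxNorm (J : Finset ℤ) : Continuous (maxNorm J) := by
  have : Continuous (J.sup fun (j : ℤ) (x : GridL2) => ‖x j‖₊) :=
    Continuous.finset_sup fun j _ => (continuous_apply j).nnnorm
  refine this.congr fun x => ?_
  rw [Finset.sup_apply]
  rfl

theorem norm_le_maxNorm {J : Finset ℤ} {j : ℤ} (hj : j ∈ J) (x : GridL2) :
    ‖x j‖ ≤ maxNorm J x := by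
  exact_mod_cast Finset.le_sup (f := fun j => ‖x j‖₊) hj

theorem maxNorm_le_norm (J : Finset ℤ) (x : GridL2) : (maxNorm J x : ℝ) ≤ ‖x‖ := by
  have : maxNorm J x ≤ ‖x‖₊ := Finset.sup_le fun j _ => norm_apply_le x j
  exact_mod_cast this

/-- Weights concentrated on the near-maximal entries of `x` on `J`. -/
def peakWeight (J : Finset ℤ) (ε : ℝ) (x : GridL2) (j : ℤ) : ℝ :=
  max 0 (‖x j‖ - maxNorm J x + ε)

theorem peakWeight_nonneg (J : Finset ℤ) (ε : ℝ) (x : GridL2) (j : ℤ) :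
    0 ≤ peakWeight J ε x j := le_max_left _ _

theorem continuous_peakWeight (J : Finset ℤ) (ε : ℝ) (j : ℤ) :
    Continuous fun x => peakWeight J ε x j := by
  exact continuous_const.max (((continuous_apply j).norm.sub
    (NNReal.continuous_coe.comp (continuous_maxNorm J))).add continuous_const)

theorem sum_peakWeight_pos {J : Finset ℤ} (hJ : J.Nonempty) {ε : ℝ} (hε : 0 < ε) (x : GridL2) :
    0 < ∑ j ∈ J, peakWeight J ε x j := by
  obtain ⟨j, hj, he⟩ := Finset.exists_mem_eq_sup J hJ fun j => ‖x j‖₊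
  refine Finset.sum_pos' (fun j _ => peakWeight_nonneg J ε x j) ⟨j, hj, ?_⟩
  have : (maxNorm J x : ℝ) = ‖x j‖ := by
    rw [maxNorm, he]; rfl
  rw [peakWeight, this]
  simpa using hε

/-- The coefficients of a test function for the cube of the maximum norm. -/
def peakCoeff (J : Finset ℤ) (ε : ℝ) (x : GridL2) (j : ℤ) : ℂ :=
  ((maxNorm J x : ℝ) ^ 2 * peakWeight J ε x j / ∑ i ∈ J, peakWeight J ε x i) • x j

/-- Continuity is the reason for averaging over near-maximal entries: a point mass at one maximiser
could jump as `x` varies, while the duality estimate needs a source continuous in time. -/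
theorem continuous_peakCoeff {J : Finset ℤ} (hJ : J.Nonempty) {ε : ℝ} (hε : 0 < ε) (j : ℤ) :
    Continuous fun x => peakCoeff J ε x j := by
  have h1 : Continuous fun x => (maxNorm J x : ℝ) :=
    NNReal.continuous_coe.comp (continuous_maxNorm J)
  have h2 : Continuous fun x => ∑ i ∈ J, peakWeight J ε x i :=
    continuous_finsetSum _ fun i _ => continuous_peakWeight J ε i
  exact (((h1.pow 2).mul (continuous_peakWeight J ε j)).div h2
    fun x => (sum_peakWeight_pos hJ hε x).ne').smul (continuous_apply j)

theorem sum_norm_peakCoeff_le {J : Finset ℤ} (hJ : J.Nonempty) {ε : ℝ} (hε : 0 < ε) (x : GridL2) :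
    ∑ j ∈ J, ‖peakCoeff J ε x j‖ ≤ (maxNorm J x : ℝ) ^ 3 := by
  have hs := sum_peakWeight_pos hJ hε x
  calc ∑ j ∈ J, ‖peakCoeff J ε x j‖
      ≤ ∑ j ∈ J, (maxNorm J x : ℝ) ^ 3 / (∑ i ∈ J, peakWeight J ε x i)
          * peakWeight J ε x j := by
        refine Finset.sum_le_sum fun j hj => ?_
        have hw := peakWeight_nonneg J ε x j
        rw [peakCoeff, norm_smul, Real.norm_of_nonneg (by positivity)]
        calc _ ≤ (maxNorm J x : ℝ) ^ 2 * peakWeight J ε x j / (∑ i ∈ J, peakWeight J ε x i)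
              * maxNorm J x := by gcongr; exact norm_le_maxNorm hj x
          _ = _ := by ring
    _ = _ := by
        rw [← Finset.mul_sum]
        field_simp

theorem le_inner_peakCoeff {J : Finset ℤ} (hJ : J.Nonempty) {ε : ℝ} (hε : 0 < ε) (x : GridL2) :
    (maxNorm J x : ℝ) ^ 4 - 2 * ε * (maxNorm J x : ℝ) ^ 3
      ≤ inner ℝ (finiteGrid J (peakCoeff J ε x)) x := by
  have hs := sum_peakWeight_pos hJ hε x
  set N : ℝ := (maxNorm J x : ℝ) with hN
  have hN0 : 0 ≤ N := (maxNorm J x).coe_nonneg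
  rw [inner_finiteGrid]
  calc N ^ 4 - 2 * ε * N ^ 3
      = ∑ j ∈ J, N ^ 2 * (N ^ 2 - 2 * ε * N) / (∑ i ∈ J, peakWeight J ε x i)
          * peakWeight J ε x j := by
        rw [← Finset.mul_sum]
        field_simp
    _ ≤ _ := by
        refine Finset.sum_le_sum fun j hj => ?_
        have hw := peakWeight_nonneg J ε x j
        rw [peakCoeff, real_inner_smul_left, real_inner_self_eq_norm_sq]
        -- A positive weight forces `|x_j| > N - ε`, hence `|x_j|² ≥ N² - 2εN`; for `ε ≥ N` the
        -- right side is not positive anyway.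
        have key : (N ^ 2 - 2 * ε * N) * peakWeight J ε x j
            ≤ ‖x j‖ ^ 2 * peakWeight J ε x j := by
          rcases hw.eq_or_lt with h0 | h0
          · simp [← h0]
          · gcongr
            have h1 : 0 < ‖x j‖ - N + ε := by
              by_contra hcon
              exact h0.ne' (max_eq_left (not_lt.1 hcon))
            rcases le_total ε N with h2 | h2
            · nlinarith [norm_nonneg (x j)]
            · nlinarith [norm_nonneg (x j), sq_nonneg ‖x j‖]
        calc _ = N ^ 2 / (∑ i ∈ J, peakWeight J ε x i)
              * ((N ^ 2 - 2 * ε * N) * peakWeight J ε x j) := by ring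
          _ ≤ N ^ 2 / (∑ i ∈ J, peakWeight J ε x i) * (‖x j‖ ^ 2 * peakWeight J ε x j) := by
              gcongr
          _ = _ := by ring

/-! ### The `L⁴(l^∞)` Strichartz estimate. -/

/-- The Strichartz estimate `L^4(l^∞)` on finitely many grid points, with a source in `L¹(l²)`. -/
theorem integral_maxNorm_pow_four_le {h K : ℝ} (hh : 0 < h) (hK : 0 < K)
    {A : GridL2 →L[ℂ] GridL2} (hdiss : IsDissipative h A) (hA : IsDispersive h K A)
    {u f : ℝ → GridL2} (hf : Continuous f)
    (hu : ∀ t, HasDerivAt u (Complex.I • A (u t) + f t) t) {a b : ℝ} (hab : a ≤ b)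
    (J : Finset ℤ) :
    ∫ t in a..b, (maxNorm J (u t) : ℝ) ^ 4
      ≤ (24 * (h * K)) ^ 2 * (‖u a‖ + ∫ t in a..b, ‖f t‖) ^ 4 := by
  have hu' : ∀ t, HasDerivAt u (realOperator (Complex.I • A) (u t) + f t) t := hu
  have huc : Continuous u := continuous_iff_continuousAt.2 fun t => (hu t).continuousAt
  have hL : 0 ≤ ‖u a‖ + ∫ t in a..b, ‖f t‖ :=
    add_nonneg (norm_nonneg _) (intervalIntegral.integral_nonneg hab fun _ _ => norm_nonneg _)
  set L := ‖u a‖ + ∫ t in a..b, ‖f t‖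
  rcases J.eq_empty_or_nonempty with rfl | hJ
  · simp [maxNorm]
    positivity
  set N : ℝ → ℝ := fun t => (maxNorm J (u t) : ℝ) with hN
  have hNc : Continuous N := NNReal.continuous_coe.comp ((continuous_maxNorm J).comp huc)
  have hN0 : ∀ t, 0 ≤ N t := fun t => (maxNorm J (u t)).coe_nonneg
  set Q := ∫ t in a..b, N t ^ 4 with hQ
  have hQ0 : 0 ≤ Q := intervalIntegral.integral_nonneg hab fun t _ => by positivity
  have hR0 : 0 ≤ ∫ t in a..b, N t ^ 3 :=
    intervalIntegral.integral_nonneg hab fun t _ => pow_nonneg (hN0 t) 3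
  have hεle : ∀ ε > 0, Q - 2 * ε * (∫ t in a..b, N t ^ 3)
      ≤ √(24 * (h * K)) * Q ^ (3 / 4 : ℝ) * L := by
    intro ε hε
    set F : ℝ → GridL2 := fun t => finiteGrid J (peakCoeff J ε (u t)) with hF
    have hFc : Continuous F := by
      refine continuous_finsetSum _ fun j _ => ?_
      exact (lp.isometry_single (E := fun _ : ℤ => ℂ) (p := 2) j).continuous.comp
        ((continuous_peakCoeff hJ hε j).comp huc)
    have h1 := integral_inner_le_of_dispersive (B := realOperator (Complex.I • A)) (F := F)
      (n := fun t => N t ^ 3) (fun x => hdiss.inner_le hh x) hFc (hNc.pow 3) (fun t => pow_nonneg (hN0 t) 3)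
      (κ := h * K) (by positivity) (fun s r hsr => by
        rw [exp_smul_realOperator_apply]
        refine (hA.abs_inner_le hh hK (sub_pos.2 hsr) J _ _).trans ?_
        have hp : 0 ≤ (r - s) ^ (-(1 / 2) : ℝ) := Real.rpow_nonneg (sub_pos.2 hsr).le _
        have e1 := sum_norm_peakCoeff_le hJ hε (u r)
        have e2 := sum_norm_peakCoeff_le hJ hε (u s)
        simp only [hN]
        gcongr) hf hu' hab
    have h2 : ∀ t, (N t ^ 3) ^ (4 / 3 : ℝ) = N t ^ 4 := fun t => by
      rw [← Real.rpow_natCast, ← Real.rpow_mul (hN0 t), ← Real.rpow_natCast]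
      norm_num
    simp only [h2] at h1
    refine le_trans ?_ h1
    have hN4 : Continuous fun t => N t ^ 4 := hNc.pow 4
    have hN3 : Continuous fun t => 2 * ε * N t ^ 3 := (hNc.pow 3).const_mul _
    rw [hQ, ← intervalIntegral.integral_const_mul, ← intervalIntegral.integral_sub
      (hN4.intervalIntegrable _ _) (hN3.intervalIntegrable _ _)]
    exact intervalIntegral.integral_mono_on hab ((hN4.sub hN3).intervalIntegrable _ _)
      ((hFc.inner huc).intervalIntegrable _ _) fun t _ => le_inner_peakCoeff hJ hε (u t)
  -- The averaging error is linear in `ε` and disappears as `ε → 0`; dividing by `Q^{3/4}`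
  -- afterwards gives the bound.
  have hQle : Q ≤ √(24 * (h * K)) * Q ^ (3 / 4 : ℝ) * L := by
    refine le_of_forall_pos_le_add fun δ hδ => ?_
    have := hεle (δ / (2 * ((∫ t in a..b, N t ^ 3) + 1))) (by positivity)
    have h2 : 2 * (δ / (2 * ((∫ t in a..b, N t ^ 3) + 1))) * (∫ t in a..b, N t ^ 3) ≤ δ := by
      rw [← mul_div_assoc, div_mul_eq_mul_div, div_le_iff₀ (by positivity)]
      nlinarith
    linarith
  rcases hQ0.eq_or_lt with h0 | h0
  · rw [← h0]; positivity
  have hq : Q ^ (1 / 4 : ℝ) ≤ √(24 * (h * K)) * L := by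
    have hq1 : Q = Q ^ (1 / 4 : ℝ) * Q ^ (3 / 4 : ℝ) := by
      rw [← Real.rpow_add h0]; norm_num
    have hq2 : 0 < Q ^ (3 / 4 : ℝ) := by positivity
    refine le_of_mul_le_mul_right ?_ hq2
    rw [← hq1]
    linarith
  calc Q = (Q ^ (1 / 4 : ℝ)) ^ 4 := by
        rw [← Real.rpow_natCast, ← Real.rpow_mul hQ0]; norm_num
    _ ≤ (√(24 * (h * K)) * L) ^ 4 := by gcongr
    _ = _ := by
        rw [mul_pow, show √(24 * (h * K)) ^ 4 = (√(24 * (h * K)) ^ 2) ^ 2 by ring,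
          Real.sq_sqrt (by positivity)]

/-- The `l^∞` norm of a grid function. -/
def supNorm (x : GridL2) : ℝ := ⨆ j : ℤ, ‖x j‖

theorem bddAbove_range_norm (x : GridL2) : BddAbove (range fun j : ℤ => ‖x j‖) :=
  ⟨‖x‖, by rintro _ ⟨j, rfl⟩; exact norm_apply_le x j⟩

theorem norm_apply_le_supNorm (x : GridL2) (j : ℤ) : ‖x j‖ ≤ supNorm x :=
  le_ciSup (bddAbove_range_norm x) j

theorem supNorm_nonneg (x : GridL2) : 0 ≤ supNorm x :=
  (norm_nonneg _).trans (norm_apply_le_supNorm x 0)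

theorem continuous_supNorm : Continuous supNorm := by
  refine (LipschitzWith.of_le_add fun x y => ciSup_le fun j => ?_).continuous
  have h1 := norm_apply_le (x - y) j
  have h2 : ‖x j‖ ≤ ‖y j‖ + ‖x j - y j‖ := by
    simpa [add_comm] using norm_add_le (x j - y j) (y j)
  have h3 := norm_apply_le_supNorm y j
  change _ ≤ supNorm y + _
  rw [dist_eq_norm]
  have h4 : (x - y) j = x j - y j := rfl
  rw [h4] at h1
  linarith

theorem tendsto_maxNorm (x : GridL2) :
    Filter.Tendsto (fun J : Finset ℤ => (maxNorm J x : ℝ)) Filter.atTop (nhds (supNorm x)) := by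
  refine tendsto_atTop_isLUB (fun J J' h => ?_) ⟨?_, fun M hM => ?_⟩
  · exact NNReal.coe_le_coe.2 (Finset.sup_mono h)
  · rintro _ ⟨J, rfl⟩
    have : maxNorm J x ≤ ⟨supNorm x, supNorm_nonneg x⟩ :=
      Finset.sup_le fun j _ => norm_apply_le_supNorm x j
    exact_mod_cast this
  · refine ciSup_le fun j => ?_
    exact (norm_le_maxNorm (Finset.mem_singleton_self j) x).trans (hM ⟨{j}, rfl⟩)

/-- The Strichartz estimate `L^4(l^∞)`, with a source in `L¹(l²)`. -/
theorem integral_supNorm_pow_four_le {h K : ℝ} (hh : 0 < h) (hK : 0 < K)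
    {A : GridL2 →L[ℂ] GridL2} (hdiss : IsDissipative h A) (hA : IsDispersive h K A)
    {u f : ℝ → GridL2} (hf : Continuous f)
    (hu : ∀ t, HasDerivAt u (Complex.I • A (u t) + f t) t) {a b : ℝ} (hab : a ≤ b) :
    ∫ t in a..b, supNorm (u t) ^ 4
      ≤ (24 * (h * K)) ^ 2 * (‖u a‖ + ∫ t in a..b, ‖f t‖) ^ 4 := by
  have huc : Continuous u := continuous_iff_continuousAt.2 fun t => (hu t).continuousAt
  refine le_of_tendsto' (intervalIntegral.tendsto_integral_filter_of_dominated_convergence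
    (F := fun (J : Finset ℤ) t => (maxNorm J (u t) : ℝ) ^ 4) (fun t => ‖u t‖ ^ 4)
    (.of_forall fun J => ?_) (.of_forall fun J => .of_forall fun t _ => ?_)
    ((huc.norm.pow 4).intervalIntegrable _ _) (.of_forall fun t _ => (tendsto_maxNorm (u t)).pow 4))
    (integral_maxNorm_pow_four_le hh hK hdiss hA hf hu hab)
  · exact ((NNReal.continuous_coe.comp
      ((continuous_maxNorm J).comp huc)).pow 4).aestronglyMeasurable
  · rw [Real.norm_of_nonneg (by positivity)]
    gcongr
    exact maxNorm_le_norm J (u t)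

/-! ### The nonlinear bound on short intervals. -/

/-- This places the nonlinearity in `L¹(l²)`, so no Strichartz estimate with other dual exponents
for the source is needed. -/
theorem norm_powerNonlinearity_le {p : ℝ} (hp : 0 ≤ p) (x : GridL2) :
    ‖powerNonlinearity hp x‖ ≤ supNorm x ^ p * ‖x‖ := by
  have h0 := supNorm_nonneg x
  refine norm_le_of_forall_norm_apply_le (by positivity) fun j => ?_
  rw [powerNonlinearity_apply, norm_mul, Complex.norm_real, Real.norm_of_nonneg (by positivity)]
  gcongr
  exact norm_apply_le_supNorm x j

theorem continuous_powerNonlinearity {p : ℝ} (hp : 0 ≤ p) :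
    Continuous (powerNonlinearity hp) := by
  have h := ((continuous_nlsField hp 0).const_smul Complex.I)
  refine h.congr fun x => ?_
  simp [nlsField, smul_smul]

theorem rpow_le_one_add_pow_four {p : ℝ} (hp : 0 ≤ p) (hp4 : p ≤ 4) {x : ℝ} (hx : 0 ≤ x) :
    x ^ p ≤ 1 + x ^ 4 := by
  rcases le_total x 1 with h | h
  · have := Real.rpow_le_one hx h hp
    have : 0 ≤ x ^ 4 := by positivity
    linarith
  · have := Real.rpow_le_rpow_of_exponent_le h hp4
    rw [show (4 : ℝ) = (4 : ℕ) by norm_num, Real.rpow_natCast] at this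
    linarith

/-- `∫ N^p ≤ 2 ℓ^{1-p/4} Q^p` on an interval of length at most `ℓ` with `∫ N⁴ = Q⁴`. -/
theorem integral_rpow_le_of_integral_pow_four_eq {p : ℝ} (hp : 0 ≤ p) (hp4 : p ≤ 4)
    {N : ℝ → ℝ} (hN : Continuous N) (hN0 : ∀ t, 0 ≤ N t) {a t l Q : ℝ} (hat : a ≤ t)
    (hl : 0 < l) (htl : t - a ≤ l) (hQ : 0 < Q) (hint : ∫ s in a..t, N s ^ 4 = Q ^ 4) :
    ∫ s in a..t, N s ^ p ≤ 2 * (l ^ (1 - p / 4) * Q ^ p) := by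
  -- `μ` is the constant height with `∫ μ⁴ = Q⁴` over length `l`. Rescaling `x^p ≤ 1 + x⁴` by it
  -- replaces Hölder's inequality at the cost of a factor `2`.
  set μ := Q * l ^ (-(1 / 4) : ℝ) with hμdef
  have hμ : 0 < μ := by positivity
  have hμ4 : μ ^ 4 = Q ^ 4 * l⁻¹ := by
    rw [hμdef, mul_pow]
    congr 1
    rw [← Real.rpow_natCast, ← Real.rpow_mul hl.le, ← Real.rpow_neg_one]
    norm_num
  have hμp : μ ^ p * l = l ^ (1 - p / 4) * Q ^ p := by
    rw [hμdef, Real.mul_rpow hQ.le (by positivity), ← Real.rpow_mul hl.le, mul_assoc,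
      ← Real.rpow_add_one hl.ne', mul_comm]
    congr 2
    ring
  have hpt : ∀ s, N s ^ p ≤ μ ^ p + μ ^ p * (μ ^ 4)⁻¹ * N s ^ 4 := by
    intro s
    have h1 := rpow_le_one_add_pow_four hp hp4 (x := N s / μ) (div_nonneg (hN0 s) hμ.le)
    rw [Real.div_rpow (hN0 s) hμ.le, div_pow, div_le_iff₀ (by positivity)] at h1
    calc N s ^ p ≤ _ := h1
      _ = _ := by ring
  have hc : Continuous fun s => N s ^ p := hN.rpow_const fun s => Or.inr hp
  have hN4 : Continuous fun s => N s ^ 4 := hN.pow 4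
  have hi := fun c => (hN4.const_mul c).intervalIntegrable (μ := volume) a t
  calc ∫ s in a..t, N s ^ p ≤ ∫ s in a..t, (μ ^ p + μ ^ p * (μ ^ 4)⁻¹ * N s ^ 4) := by
        refine intervalIntegral.integral_mono_on hat (hc.intervalIntegrable _ _)
          (intervalIntegrable_const.add (hi _)) fun s _ => hpt s
    _ = (t - a) * μ ^ p + μ ^ p * (μ ^ 4)⁻¹ * Q ^ 4 := by
        rw [intervalIntegral.integral_add intervalIntegrable_const (hi _),
          intervalIntegral.integral_const, intervalIntegral.integral_const_mul, hint, smul_eq_mul]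
    _ = (t - a) * μ ^ p + μ ^ p * l := by
        rw [hμ4]
        field_simp
    _ ≤ l * μ ^ p + μ ^ p * l := by gcongr
    _ = 2 * (l ^ (1 - p / 4) * Q ^ p) := by rw [← hμp]; ring

/-- On short intervals the `L^4(l^∞)` norm of a solution is controlled by its `l²` norm. -/
theorem integral_supNorm_pow_four_le_of_short {p : ℝ} (hp : 0 ≤ p) (hp4 : p < 4) {h K : ℝ}
    (hh : 0 < h) (hK : 0 < K) {A : GridL2 →L[ℂ] GridL2} (hdiss : IsDissipative h A)
    (hA : IsDispersive h K A) {u : ℝ → GridL2} (hu : ∀ t, HasDerivAt u (nlsField hp A (u t)) t)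
    {a b Φ : ℝ} (hab : a ≤ b) (hΦ0 : 0 < Φ) (hΦ : ∀ t ∈ Icc a b, ‖u t‖ ≤ Φ)
    (hlen : (b - a) ^ (1 - p / 4) * (2 * √(24 * K) * (√h * Φ)) ^ p ≤ 1 / 4) :
    ∫ t in a..b, supNorm (u t) ^ 4 ≤ (2 * √(24 * K) * (√h * Φ)) ^ 4 := by
  set Q := 2 * √(24 * K) * (√h * Φ) with hQdef
  have hQ : 0 < Q := by positivity
  have huc : Continuous u := continuous_iff_continuousAt.2 fun t => (hu t).continuousAt
  have hNc : Continuous fun t => supNorm (u t) := continuous_supNorm.comp huc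
  by_contra! hcon
  have hab' : a < b := by
    refine hab.lt_of_ne fun h => ?_
    rw [h, intervalIntegral.integral_same] at hcon
    exact absurd hcon (not_lt.2 (by positivity))
  have hMc : Continuous fun t => ∫ s in a..t, supNorm (u s) ^ 4 :=
    intervalIntegral.continuous_primitive (fun _ _ => (hNc.pow 4).intervalIntegrable _ _) a
  -- Continuity argument: if the bound failed, the integral would equal `Q⁴` exactly at some `t`,
  -- and the estimate on `[a, t]` excludes this.
  obtain ⟨t, ht, htQ⟩ := intermediate_value_Icc hab hMc.continuousOn
    ⟨(intervalIntegral.integral_same.trans_le (by positivity : (0 : ℝ) ≤ Q ^ 4)), hcon.le⟩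
  simp only at htQ
  set f : ℝ → GridL2 := fun s => -(Complex.I • powerNonlinearity hp (u s))
  have hf : Continuous f :=
    (((continuous_powerNonlinearity hp).comp huc).const_smul Complex.I).neg
  have hstr := integral_supNorm_pow_four_le hh hK hdiss hA hf
    (fun s => (hu s).congr_deriv (sub_eq_add_neg _ _)) ht.1
  have hNp := integral_rpow_le_of_integral_pow_four_eq hp hp4.le hNc
    (fun s => supNorm_nonneg (u s)) ht.1 (sub_pos.2 hab') (by linarith [ht.2]) hQ htQ
  have hfint : ∫ s in a..t, ‖f s‖ ≤ Φ * ∫ s in a..t, supNorm (u s) ^ p := by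
    rw [← intervalIntegral.integral_const_mul]
    refine intervalIntegral.integral_mono_on ht.1 (hf.norm.intervalIntegrable _ _)
      (((hNc.rpow_const fun s => Or.inr hp).const_mul Φ).intervalIntegrable _ _) fun s hs => ?_
    have h0 := supNorm_nonneg (u s)
    calc ‖f s‖ = ‖powerNonlinearity hp (u s)‖ := by
          simp only [f]; rw [norm_neg, norm_smul, Complex.norm_I, one_mul]
      _ ≤ supNorm (u s) ^ p * ‖u s‖ := norm_powerNonlinearity_le hp (u s)
      _ ≤ supNorm (u s) ^ p * Φ := by gcongr; exact hΦ s ⟨hs.1, hs.2.trans ht.2⟩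
      _ = _ := mul_comm _ _
  -- The length condition makes `∫ ‖u‖_∞^p` at most `2 · 1/4`, so the source adds at most `Φ/2`.
  have hL : ‖u a‖ + ∫ s in a..t, ‖f s‖ ≤ 3 / 2 * Φ := by
    have := hΦ a ⟨le_rfl, hab⟩
    nlinarith
  have hL0 : 0 ≤ ‖u a‖ + ∫ s in a..t, ‖f s‖ :=
    add_nonneg (norm_nonneg _) (intervalIntegral.integral_nonneg ht.1 fun _ _ => norm_nonneg _)
  rw [htQ] at hstr
  have hfin : Q ^ 4 ≤ (24 * (h * K)) ^ 2 * (3 / 2 * Φ) ^ 4 := hstr.trans (by gcongr)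
  -- The factor `2` in `Q` leaves room: `2⁴ = 16` exceeds `(3/2)⁴`, which is the contradiction.
  have hQ4 : Q ^ 4 = 16 * ((24 * (h * K)) ^ 2 * Φ ^ 4) := by
    have e1 : √(24 * K) ^ 2 = 24 * K := Real.sq_sqrt (by positivity)
    have e2 : √h ^ 2 = h := Real.sq_sqrt hh.le
    calc Q ^ 4 = 16 * ((√(24 * K) ^ 2) ^ 2 * ((√h ^ 2) ^ 2 * Φ ^ 4)) := by rw [hQdef]; ring
      _ = _ := by rw [e1, e2]; ring
  have hpos : 0 < (24 * (h * K)) ^ 2 * Φ ^ 4 := by positivity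
  rw [hQ4] at hfin
  nlinarith

/-! ### Interpolation to all admissible pairs. -/

theorem gridNorm_top_le {h : ℝ} (hh : 0 < h) (x : GridL2) :
    gridNorm h ∞ (fun j => x j) ≤ ENNReal.ofReal (supNorm x) := by
  rw [gridNorm_top hh]
  refine iSup_le fun j => ?_
  rw [← ofReal_norm]
  exact ENNReal.ofReal_le_ofReal (norm_apply_le_supNorm x j)

/-- Interpolation of the `l^r` norm between `l²` and `l^∞`. -/
theorem gridNorm_le_interpolation (h : ℝ) {r : ℝ≥0∞} (hr2 : 2 ≤ r) (hr : r ≠ ∞) (x : GridL2) :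
    gridNorm h r (fun j => x j) ≤ gridNorm h 2 (fun j => x j) ^ (2 / r.toReal)
      * ENNReal.ofReal (supNorm x) ^ (1 - 2 / r.toReal) := by
  have hr0 : r ≠ 0 := (lt_of_lt_of_le (by norm_num) hr2).ne'
  have hρ : (2 : ℝ) ≤ r.toReal := by
    simpa using ENNReal.toReal_mono hr hr2
  set ρ := r.toReal
  set Y := ENNReal.ofReal (supNorm x)
  have hY : ∀ j, ‖x j‖ₑ ≤ Y := fun j => by
    rw [← ofReal_norm]
    exact ENNReal.ofReal_le_ofReal (norm_apply_le_supNorm x j)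
  rw [gridNorm_eq_tsum h hr0 hr, gridNorm_eq_tsum h two_ne_zero ENNReal.ofNat_ne_top,
    ENNReal.toReal_ofNat, ← ENNReal.rpow_mul]
  have hsum : ∑' j : ℤ, ‖x j‖ₑ ^ ρ ≤ (∑' j : ℤ, ‖x j‖ₑ ^ (2 : ℝ)) * Y ^ (ρ - 2) := by
    rw [← ENNReal.tsum_mul_right]
    refine ENNReal.tsum_le_tsum fun j => ?_
    calc ‖x j‖ₑ ^ ρ = ‖x j‖ₑ ^ (2 : ℝ) * ‖x j‖ₑ ^ (ρ - 2) := by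
          rw [← ENNReal.rpow_add_of_nonneg _ _ (by norm_num) (by linarith)]
          congr 1; ring
      _ ≤ _ := mul_le_mul_right (ENNReal.rpow_le_rpow (hY j) (by linarith)) _
  calc (ENNReal.ofReal h * ∑' j : ℤ, ‖x j‖ₑ ^ ρ) ^ (1 / ρ)
      ≤ (ENNReal.ofReal h * (∑' j : ℤ, ‖x j‖ₑ ^ (2 : ℝ)) * Y ^ (ρ - 2)) ^ (1 / ρ) := by
        rw [mul_assoc]; gcongr
    _ = (ENNReal.ofReal h * (∑' j : ℤ, ‖x j‖ₑ ^ (2 : ℝ))) ^ (1 / ρ) * Y ^ (1 - 2 / ρ) := by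
        rw [ENNReal.mul_rpow_of_nonneg _ _ (by positivity), ← ENNReal.rpow_mul]
        congr 2
        field_simp
    _ = _ := by
        congr 2
        ring

theorem IsAdmissible.eq_four {q : ℝ≥0∞} (h : IsAdmissible q ∞) : q = 4 := by
  have := h.2.2
  rw [ENNReal.inv_top, tsub_zero, ← ENNReal.mul_inv (by simp) (by simp), inv_inj] at this
  rw [this]; norm_num

theorem IsAdmissible.eq_top {q : ℝ≥0∞} (h : IsAdmissible q 2) : q = ∞ := by
  have := h.2.2
  rwa [tsub_self, mul_zero, ENNReal.inv_eq_zero] at this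

theorem IsAdmissible.four_div_eq {q r : ℝ≥0∞} (h : IsAdmissible q r) :
    4 / q.toReal = 1 - 2 / r.toReal := by
  have h1 := congrArg ENNReal.toReal h.2.2
  rw [ENNReal.toReal_mul, ENNReal.toReal_sub_of_le (ENNReal.inv_le_inv.2 h.2.1) (by simp),
    ENNReal.toReal_inv, ENNReal.toReal_inv, ENNReal.toReal_inv, ENNReal.toReal_ofNat] at h1
  rw [div_eq_mul_inv, h1]
  ring

/-- Away from the endpoints `(4, ∞)` and `(∞, 2)`, put `θ = 2/r`. Admissibility says `(1 - θ) q =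
4`, so the `q`-th power of the interpolated norm is `X^{θq}` times exactly the fourth power of the
supremum. The condition `1 ≤ D` absorbs `X^θ` into `(DX)^θ`. -/
theorem mixedNorm_le_of_interpolation {h : ℝ} (hh : 0 < h) {q r : ℝ≥0∞} (hqr : IsAdmissible q r)
    {a b : ℝ} {u : ℝ → GridL2} {X : ℝ≥0∞} (hX : X ≠ ∞) {D : ℝ≥0∞} (hD : 1 ≤ D)
    (hu : ∀ t ∈ Icc a b, gridNorm h 2 (fun j => u t j) ≤ X)
    (hu4 : ∫⁻ t in Icc a b, ENNReal.ofReal (supNorm (u t)) ^ (4 : ℝ) ≤ (D * X) ^ (4 : ℝ)) :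
    mixedNorm h q r (Icc a b) u ≤ D * X := by
  have hXD : X ≤ D * X := le_mul_of_one_le_left zero_le hD
  rcases eq_or_ne r ∞ with rfl | hr
  · rw [hqr.eq_four, mixedNorm, eLpNorm_eq_lintegral_rpow_enorm_toReal (by norm_num) (by norm_num),
      ENNReal.toReal_ofNat]
    calc _ ≤ ((D * X) ^ (4 : ℝ)) ^ (1 / 4 : ℝ) := by
          gcongr
          refine le_trans (lintegral_mono fun t => ?_) hu4
          gcongr
          exact gridNorm_top_le hh (u t)
      _ = D * X := by rw [← ENNReal.rpow_mul]; norm_num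
  rcases eq_or_ne r 2 with rfl | hr2
  · rw [hqr.eq_top, mixedNorm, eLpNorm_exponent_top]
    refine (eLpNormEssSup_le_of_ae_enorm_bound ?_).trans hXD
    filter_upwards [ae_restrict_mem measurableSet_Icc] with t ht using hu t ht
  have hρ : (2 : ℝ) < r.toReal := by
    have := (ENNReal.toReal_lt_toReal ENNReal.ofNat_ne_top hr).2 (hqr.2.1.lt_of_ne' hr2)
    simpa using this
  have hrel := hqr.four_div_eq
  have hθ : 2 / r.toReal < 1 := (div_lt_one (by linarith)).2 hρ
  have hs : 0 < q.toReal := by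
    by_contra hcon
    have : 4 / q.toReal ≤ 0 := div_nonpos_of_nonneg_of_nonpos (by norm_num) (not_lt.1 hcon)
    linarith
  obtain ⟨hq0, hqt⟩ := ENNReal.toReal_pos_iff.1 hs
  set s := q.toReal
  set θ := 2 / r.toReal with hθdef
  have hθ0 : 0 ≤ θ := by positivity
  rw [mixedNorm, eLpNorm_eq_lintegral_rpow_enorm_toReal hq0.ne' hqt.ne]
  have hpt : ∀ t ∈ Icc a b, ‖gridNorm h r (fun j => u t j)‖ₑ ^ s
      ≤ X ^ (θ * s) * ENNReal.ofReal (supNorm (u t)) ^ (4 : ℝ) := by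
    intro t ht
    rw [enorm_eq_self]
    calc _ ≤ (X ^ θ * ENNReal.ofReal (supNorm (u t)) ^ (4 / s)) ^ s := by
          refine ENNReal.rpow_le_rpow ((gridNorm_le_interpolation h hqr.2.1 hr (u t)).trans ?_) hs.le
          rw [hrel]
          gcongr
          exact hu t ht
      _ = _ := by
          rw [ENNReal.mul_rpow_of_nonneg _ _ hs.le, ← ENNReal.rpow_mul, ← ENNReal.rpow_mul,
            div_mul_cancel₀ _ hs.ne']
  calc _ ≤ (∫⁻ t in Icc a b, X ^ (θ * s) * ENNReal.ofReal (supNorm (u t)) ^ (4 : ℝ)) ^ (1 / s) := by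
        exact ENNReal.rpow_le_rpow (setLIntegral_mono' measurableSet_Icc hpt) (by positivity)
    _ ≤ (X ^ (θ * s) * (D * X) ^ (4 : ℝ)) ^ (1 / s) := by
        rw [lintegral_const_mul' _ _ (ENNReal.rpow_ne_top_of_nonneg (by positivity) hX)]
        gcongr
    _ = X ^ θ * (D * X) ^ (4 / s) := by
        rw [ENNReal.mul_rpow_of_nonneg _ _ (by positivity), ← ENNReal.rpow_mul, ← ENNReal.rpow_mul]
        congr 2
        · field_simp
        · ring
    _ ≤ (D * X) ^ θ * (D * X) ^ (4 / s) := by gcongr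
    _ = D * X := by
        rw [← ENNReal.rpow_add_of_nonneg _ _ hθ0 (by positivity), hrel]
        simp

/-! ### The time constant and the space-time bounds. -/

/-- The time constant of the main theorem. -/
def timeConstant (p K : ℝ) : ℝ := (1 / (4 * (2 * √(24 * K)) ^ p)) ^ (4 / (4 - p))

theorem timeConstant_pos (p : ℝ) {K : ℝ} (hK : 0 < K) : 0 < timeConstant p K := by
  unfold timeConstant
  positivity

/-- The exponents `4/(4-p)` and `1 - p/4` are inverse to each other, so the powers of `X` and of
`2√(24K)` cancel and `1/4` remains. -/
theorem rpow_mul_rpow_le_of_le_timeConstant {p K l X : ℝ} (hp4 : p < 4) (hK : 0 < K)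
    (hl : 0 ≤ l) (hX : 0 < X) (h : l ≤ timeConstant p K * X ^ (-(4 * p / (4 - p)))) :
    l ^ (1 - p / 4) * (2 * √(24 * K) * X) ^ p ≤ 1 / 4 := by
  have h4 : 4 - p ≠ 0 := by linarith
  set D := 2 * √(24 * K) with hD
  have hD0 : 0 < D := by positivity
  have hc : timeConstant p K ^ (1 - p / 4) = 1 / (4 * D ^ p) := by
    rw [timeConstant, ← Real.rpow_mul (by positivity),
      show 4 / (4 - p) * (1 - p / 4) = 1 by field_simp, Real.rpow_one]
  have hx : (X ^ (-(4 * p / (4 - p)))) ^ (1 - p / 4) = X ^ (-p) := by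
    rw [← Real.rpow_mul hX.le]
    congr 1
    field_simp
  calc _ ≤ (timeConstant p K * X ^ (-(4 * p / (4 - p)))) ^ (1 - p / 4) * (D * X) ^ p := by
        gcongr
        linarith
    _ = 1 / (4 * D ^ p) * X ^ (-p) * (D ^ p * X ^ p) := by
        rw [Real.mul_rpow (timeConstant_pos p hK).le (by positivity), hc, hx,
          Real.mul_rpow hD0.le hX.le]
    _ = 1 / 4 := by
        rw [Real.rpow_neg hX.le]
        have h1 : D ^ p ≠ 0 := by positivity
        have h2 : X ^ p ≠ 0 := by positivity
        field_simp

/-- The space-time bounds on any time set where the `l²` norm does not exceed its initial value. -/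
theorem satisfiesBounds_of_norm_le {p : ℝ} (hp : 0 ≤ p) (hp4 : p < 4) {h K : ℝ}
    (hh : 0 < h) (hK : 0 < K) {A : GridL2 →L[ℂ] GridL2} (hdiss : IsDissipative h A)
    (hA : IsDispersive h K A) {u : ℝ → GridL2} (hu : ∀ t, HasDerivAt u (nlsField hp A (u t)) t)
    {φ : GridL2} {J : Set ℝ} (hJ : ∀ t ∈ J, ‖u t‖ ≤ ‖φ‖) :
    SatisfiesBounds h p (timeConstant p K)
      (fun _ => max 1 (2 * √(24 * K)).toNNReal) φ J u := by
  have henergy : ∀ t ∈ J, gridNorm h 2 (fun j => u t j) ≤ gridNorm h 2 (fun j => φ j) := by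
    intro t ht
    rw [gridNorm_two hh.le, gridNorm_two hh.le]
    exact ENNReal.ofReal_le_ofReal (by gcongr; exact hJ t ht)
  refine ⟨henergy, fun q r hqr a b hab hIJ hlen => ?_⟩
  have huc : Continuous u := continuous_iff_continuousAt.2 fun t => (hu t).continuousAt
  have hNc : Continuous fun t => supNorm (u t) := continuous_supNorm.comp huc
  have hX : gridNorm h 2 (fun j => φ j) = ENNReal.ofReal (√h * ‖φ‖) := gridNorm_two hh.le φ
  refine mixedNorm_le_of_interpolation hh hqr (by rw [hX]; exact ENNReal.ofReal_ne_top)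
    (by exact_mod_cast le_max_left _ _) (fun t ht => henergy t (hIJ ht)) ?_
  have hreal : ∫ t in a..b, supNorm (u t) ^ 4 ≤ (2 * √(24 * K) * (√h * ‖φ‖)) ^ 4 := by
    -- The short-interval bound needs positive mass; for `φ = 0` the solution vanishes on the
    -- interval.
    rcases (norm_nonneg φ).eq_or_lt with h0 | h0
    · have : ∀ t ∈ uIcc a b, supNorm (u t) ^ 4 = 0 := by
        intro t ht
        rw [uIcc_of_le hab] at ht
        have h1 := hJ t (hIJ ht)
        rw [← h0] at h1
        have h2 : supNorm (u t) = 0 := le_antisymm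
          (ciSup_le fun j => (norm_apply_le (u t) j).trans h1) (supNorm_nonneg _)
        simp [h2]
      rw [intervalIntegral.integral_congr this]
      simp
      positivity
    · refine integral_supNorm_pow_four_le_of_short hp hp4 hh hK hdiss hA hu hab h0
        (fun t ht => hJ t (hIJ ht)) ?_
      have hX0 : 0 < √h * ‖φ‖ := by positivity
      refine rpow_mul_rpow_le_of_le_timeConstant hp4 hK (sub_nonneg.2 hab) hX0 ?_
      have hc := timeConstant_pos p hK
      rw [hX, ENNReal.ofReal_rpow_of_pos hX0, ← ENNReal.ofReal_mul hc.le] at hlen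
      exact (ENNReal.ofReal_le_ofReal_iff (by positivity)).1 hlen
  have hN4 : Continuous fun t => supNorm (u t) ^ 4 := hNc.pow 4
  have hconv : ∫⁻ t in Icc a b, ENNReal.ofReal (supNorm (u t)) ^ (4 : ℝ)
      = ENNReal.ofReal (∫ t in a..b, supNorm (u t) ^ 4) := by
    rw [intervalIntegral.integral_of_le hab, ← integral_Icc_eq_integral_Ioc,
      ofReal_integral_eq_lintegral_ofReal hN4.integrableOn_Icc
      (.of_forall fun t => pow_nonneg (supNorm_nonneg _) 4)]
    refine lintegral_congr fun t => ?_
    rw [ENNReal.ofReal_pow (supNorm_nonneg _)]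
    exact_mod_cast ENNReal.rpow_natCast _ 4
  rw [hconv]
  calc _ ≤ ENNReal.ofReal ((2 * √(24 * K) * (√h * ‖φ‖)) ^ 4) := ENNReal.ofReal_le_ofReal hreal
    _ = (ENNReal.ofReal (2 * √(24 * K)) * ENNReal.ofReal (√h * ‖φ‖)) ^ (4 : ℝ) := by
        rw [ENNReal.ofReal_pow (by positivity), ENNReal.ofReal_mul (by positivity)]
        exact_mod_cast (ENNReal.rpow_natCast _ 4).symm
    _ ≤ _ := by
        rw [hX]
        gcongr
        exact ENNReal.coe_le_coe.2 (le_max_right _ _)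

end SemiDiscreteNLS

end

theorem mainTheorem12 (p : ℝ) (hp0 : 0 < p) (hp4 : p < 4) (K : ℝ) (hK : 0 < K) :
    ∃ c : ℝ, 0 < c ∧ ∃ C : ℝ≥0∞ → ℝ≥0, (∀ q, 0 < C q) ∧
      ∀ h : ℝ, 0 < h →
      ∀ A : SemiDiscreteNLS.GridL2 →L[ℂ] SemiDiscreteNLS.GridL2,
        SemiDiscreteNLS.IsDissipative h A → SemiDiscreteNLS.IsDispersive h K A →
      ∀ φ : SemiDiscreteNLS.GridL2,
        ∃ u : ℝ → SemiDiscreteNLS.GridL2,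
          SemiDiscreteNLS.IsSolutionOn p A φ univ u ∧
          (∀ v, SemiDiscreteNLS.IsSolutionOn p A φ univ v → v = u) ∧
          (∀ v, SemiDiscreteNLS.IsSolutionOn p A φ (Ici 0) v → EqOn v u (Ici 0)) ∧
          SemiDiscreteNLS.SatisfiesBounds h p c C φ (Ici 0) u ∧
          (SemiDiscreteNLS.IsConservative h A →
            SemiDiscreteNLS.SatisfiesBounds h p c C φ univ u) := by
  -- One constant serves every `q`: the entry `1` covers the energy endpoint and `2√(24K)` the
  -- `L⁴(l^∞)` endpoint.
  refine ⟨_, SemiDiscreteNLS.timeConstant_pos p hK, fun _ => max 1 (2 * √(24 * K)).toNNReal,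
    fun _ => lt_max_of_lt_left one_pos, fun h hh A hdiss hdisp φ => ?_⟩
  obtain ⟨u, hu⟩ := SemiDiscreteNLS.exists_isSolutionOn_univ hp0.le A φ
  have hd := fun t => hu.hasDerivAt hp0.le (t := t) (by simp)
  refine ⟨u, hu, fun v hv => hu.eq_of_univ hp0.le hv, fun v hv => hu.eqOn_Ici hp0.le hv, ?_,
    fun hcons => ?_⟩
  · refine SemiDiscreteNLS.satisfiesBounds_of_norm_le hp0.le hp4 hh hK hdiss hdisp hd
      fun t ht => ?_
    rw [← hu.initial]
    exact SemiDiscreteNLS.norm_antitone_of_dissipative hp0.le (hdiss.inner_le hh) hd ht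
  · refine SemiDiscreteNLS.satisfiesBounds_of_norm_le hp0.le hp4 hh hK hdiss hdisp hd
      fun t _ => ?_
    rw [← hu.initial]
    exact (SemiDiscreteNLS.norm_eq_of_conservative hp0.le (hcons.inner_eq hh) hd t 0).le
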